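/- All graphs are finite and simple. For (families of) graphs $\mathcal G,\mathcal H$, let $r(\mathcal G,\mathcal H)$ be the smallest $N$ such that every 2-colouring of the edges of $K_N$ contains a (not necessarily induced) copy of some $G\in\mathcal G$ in the first colour or a copy of some $H\in\mathcal H$ in the second colour; a single graph is identified with the family consisting of it alone. Write $|G|$ for the number of vertices of $G$, $nH$ for the disjoint union of $n$ copies of $H$, and $\mathcal D(G)$ for the class of graphs obtained from $G$ by removing the vertices of an (inclusion-)maximal independent set of $G$. Then there is an absolute constant $C>0$ such that the following holds. Let $G$ be a graph with at least one edge and $H$ a connected graph, both of maximum degree at most $\Delta$, and let $k=\max\{|G|,|H|\}$. Then, for every integer $$n\ \ge\ 2^{C\Delta(\log_2\Delta)^2}\,\frac{k}{|H|},$$ we have $$r(G,nH)=n|H|+r(\mathcal D(G),H)-1 .$$ -/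

import Mathlib

/-- The Ramsey number `r(𝒢, ℋ)` of two (indexed) families of graphs: the smallest `N` such that
every 2-colouring of the edges of the complete graph on `N` vertices contains a (not necessarily
induced) copy of some member of `𝒢` in the first colour or of some member of `ℋ` in the second.
A 2-colouring of the edges of `K_N` is given by the graph `R` of the edges of the first colour; the
edges of the second colour then form the complement `Rᶜ`. -/
noncomputable def ramseyFamily {ι κ : Type*} {V : ι → Type*} {W : κ → Type*}
    (𝒢 : ∀ i, SimpleGraph (V i)) (ℋ : ∀ j, SimpleGraph (W j)) : ℕ :=
  sInf {N : ℕ | ∀ R : SimpleGraph (Fin N),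
    (∃ i, (𝒢 i).IsContained R) ∨ (∃ j, (ℋ j).IsContained Rᶜ)}

/-- The Ramsey number `r(G, H)` of two graphs. -/
noncomputable def ramseyNumber {V W : Type*} (G : SimpleGraph V) (H : SimpleGraph W) : ℕ :=
  ramseyFamily (fun _ : Unit => G) (fun _ : Unit => H)

/-- `nH`: the disjoint union of `n` copies of `H`. -/
def disjointCopies {W : Type*} (n : ℕ) (H : SimpleGraph W) : SimpleGraph (Fin n × W) where
  Adj x y := x.1 = y.1 ∧ H.Adj x.2 y.2
  symm := ⟨fun _ _ h => ⟨h.1.symm, h.2.symm⟩⟩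
  loopless := ⟨fun _ h => H.irrefl h.2⟩

/-- The inclusion-maximal independent sets of `G`. -/
def MaxIndepSet {V : Type*} (G : SimpleGraph V) : Type _ :=
  {S : Set V // Maximal G.IsIndepSet S}

/-- The family `𝒟(G)` of all graphs obtained from `G` by removing the vertices of a maximal
independent set. -/
def derivedFamily {V : Type*} (G : SimpleGraph V) (S : MaxIndepSet G) :
    SimpleGraph ↥(S.1ᶜ) :=
  G.induce S.1ᶜ

/-! Call edges of `R` red and edges of `Rᶜ` blue, and write r for the Ramsey number of 𝒟(G) and H.

Lower bound: take a blue clique on n|H| - 1 vertices and join it in red to a colouring on r - 1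
vertices avoiding 𝒟(G) and H. The part of a red G inside the clique is independent, so the rest
would contain a member of 𝒟(G). Each blue H, being connected, would lie on one side, and the clique
is too small for n of them (`exists_avoiding`).

Upper bound: let `R` be G-free on n|H| + r - 1 vertices. Greedy embedding shows that `R` has sparse
pairs at every large scale; iterating yields a large set B of small red degree
(`exists_sparse_set`). Outside B, remove blue copies of H until a bounded set L is left. Let E
consist of the vertices of L that are red to almost all of B. A red member of 𝒟(G) in E would extend
into B to a red G (`isContained_of_derivedFamily`), so any r vertices of E contain a blue H, and E
can be tiled up to at most r - 1 vertices. Every vertex of L outside E has many blue neighbours in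
B, and a switching argument places the missing copies of H in these vertices and B, up to using all
of them (`exists_packing`). So at most r - 1 vertices need be wasted, which is exactly the number
available.

For Δ = 1 the logarithm vanishes and n need not be large; that case follows from the Ramsey number
of two matchings. -/

section
open Finset
open scoped Classical

/-! ### Sparse sets in `G`-free graphs -/

/-- Greedy embedding: partial embeddings of `G` into a hereditarily dense vertex set, keeping all
candidate sets large. -/
theorem exists_partial_embedding {V α : Type*} [Fintype V] (G : SimpleGraph V) (R : SimpleGraph α)
    (U : Finset α) (q Δ : ℕ) (hq : 1 ≤ q) (hΔ : 1 ≤ Δ)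
    (hG : ∀ v, #{w | G.Adj v w} ≤ Δ) (hU : 2 * q ^ Δ * Fintype.card V ≤ #U)
    (hdense : ∀ A ⊆ U, ∀ A' ⊆ U, #U ≤ 2 * Δ * q ^ Δ * #A → #U ≤ 2 * Δ * q ^ Δ * #A' →
      ∃ x ∈ A, #A' ≤ q * #{y ∈ A' | R.Adj x y}) (T : Finset V) :
    ∃ f : V → α, (∀ v ∈ T, f v ∈ U) ∧ Set.InjOn f T ∧
      (∀ v ∈ T, ∀ w ∈ T, G.Adj v w → R.Adj (f v) (f w)) ∧
      ∀ v ∉ T, #U ≤ q ^ #{w ∈ T | G.Adj v w} *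
        #{x ∈ U | ∀ w ∈ T, G.Adj v w → R.Adj x (f w)} := by
  induction T using Finset.induction_on with
  | empty =>
    rcases isEmpty_or_nonempty V with hV | hV
    · exact ⟨fun v => (hV.false v).elim, by simp, by simp, by simp, fun v => (hV.false v).elim⟩
    · have : 0 < #U := lt_of_lt_of_le (by have := Fintype.card_pos (α := V); positivity) hU
      obtain ⟨x, -⟩ := card_pos.1 this
      exact ⟨fun _ => x, by simp, by simp, by simp, by simp⟩
  | insert a T ha ih =>
    obtain ⟨f, hfU, hfi, hfadj, hcand⟩ := ih
    set C : V → Finset α := fun v => {x ∈ U | ∀ w ∈ T, G.Adj v w → R.Adj x (f w)} with hC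
    have hCU : ∀ v, C v ⊆ U := fun v => filter_subset _ _
    have hdeg : ∀ v, q ^ #{w ∈ T | G.Adj v w} ≤ q ^ Δ := fun v =>
      Nat.pow_le_pow_right hq ((card_le_card (filter_subset_filter _ (subset_univ _))).trans (hG v))
    have hCbig : ∀ v ∉ T, #U ≤ q ^ Δ * #(C v) := fun v hv =>
      (hcand v hv).trans (Nat.mul_le_mul_right _ (hdeg v))
    -- Images of `a` that would shrink the candidate set of `w` by more than a factor `q`. Density
    -- applied to `bad w` and `C w` bounds their number.
    set bad : V → Finset α := fun w =>
      {x ∈ C a | q * #{y ∈ C w | R.Adj x y} < #(C w)} with hbad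
    set b := #U / (2 * Δ * q ^ Δ) with hb
    have hpos : 0 < 2 * Δ * q ^ Δ := by positivity
    have hbadcard : ∀ w ∉ T, #(bad w) ≤ b := by
      intro w hw
      by_contra hlt
      have h1 : #U ≤ 2 * Δ * q ^ Δ * #(bad w) := by
        rw [hb, Nat.le_div_iff_mul_le hpos] at hlt
        linarith [not_le.1 hlt, mul_comm (#(bad w)) (2 * Δ * q ^ Δ)]
      have h2 : #U ≤ 2 * Δ * q ^ Δ * #(C w) := by
        refine (hCbig w hw).trans (Nat.mul_le_mul_right _ ?_)
        nlinarith [Nat.one_le_pow Δ q hq]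
      obtain ⟨x, hx, hx'⟩ := hdense _ ((filter_subset _ _).trans (hCU a)) _ (hCU w) h1 h2
      exact absurd (mem_filter.1 hx).2 (not_lt.2 hx')
    set W : Finset V := {w | G.Adj a w ∧ w ∉ T} with hW
    have hWc : #W ≤ Δ :=
      (card_le_card (fun w hw => by simp [hW] at hw ⊢; exact hw.1)).trans (hG a)
    -- Used images and bad vertices each take at most half of `#U / q ^ Δ`; since `a` itself is not
    -- yet placed, the bound is strict.
    have hunion : #(T.image f ∪ W.biUnion bad) < #(C a) := by
      have h1 : #(W.biUnion bad) ≤ #W * b :=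
        card_biUnion_le_card_mul _ _ _ fun w hw => hbadcard w (by simp [hW] at hw; exact hw.2)
      have h2 : #(T.image f) ≤ #T := card_image_le
      have h3 : #T + 1 ≤ Fintype.card V := by
        rw [← card_insert_of_notMem ha]; exact card_le_univ _
      have h4 : b * (2 * Δ * q ^ Δ) ≤ #U := Nat.div_mul_le_self _ _
      have h5 := hCbig a ha
      have h6 := card_union_le (T.image f) (W.biUnion bad)
      have h7 : #W * b ≤ Δ * b := Nat.mul_le_mul_right _ hWc
      have hqp : 0 < q ^ Δ := by positivity
      refine lt_of_mul_lt_mul_left (a := 2 * q ^ Δ) ?_ (Nat.zero_le _)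
      calc 2 * q ^ Δ * #(T.image f ∪ W.biUnion bad) ≤ 2 * q ^ Δ * (#T + Δ * b) :=
            Nat.mul_le_mul_left _ (by omega)
        _ = 2 * q ^ Δ * #T + b * (2 * Δ * q ^ Δ) := by ring
        _ < 2 * q ^ Δ * (#T + 1) + #U := by nlinarith
        _ ≤ 2 * q ^ Δ * Fintype.card V + #U := by gcongr
        _ ≤ 2 * #U := by omega
        _ ≤ 2 * (q ^ Δ * #(C a)) := by omega
        _ = _ := by ring
    obtain ⟨x, hxC, hx⟩ := exists_mem_notMem_of_card_lt_card hunion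
    simp only [mem_union, mem_image, mem_biUnion, not_or, not_exists, not_and] at hx
    obtain ⟨hxT, hxbad⟩ := hx
    have hxU := hCU a hxC
    have hxadj := (mem_filter.1 hxC).2
    have hne : ∀ {v}, v ∈ T → v ≠ a := fun hv h => ha (h ▸ hv)
    refine ⟨Function.update f a x, ?_, ?_, ?_, ?_⟩
    · intro v hv
      rcases mem_insert.1 hv with rfl | hv
      · simpa
      · simpa [Function.update_of_ne (hne hv)] using hfU v hv
    · intro v hv w hw h
      rcases mem_insert.1 (mem_coe.1 hv) with rfl | hv' <;>
        rcases mem_insert.1 (mem_coe.1 hw) with rfl | hw'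
      · rfl
      · rw [Function.update_self, Function.update_of_ne (hne hw')] at h
        exact absurd h.symm (hxT w hw')
      · rw [Function.update_self, Function.update_of_ne (hne hv')] at h
        exact absurd h (hxT v hv')
      · rw [Function.update_of_ne (hne hw'), Function.update_of_ne (hne hv')] at h
        exact hfi hv' hw' h
    · intro v hv w hw h
      rcases mem_insert.1 hv with rfl | hv' <;> rcases mem_insert.1 hw with rfl | hw'
      · exact absurd h (G.irrefl)
      · rw [Function.update_self, Function.update_of_ne (hne hw')]
        exact hxadj w hw' h
      · rw [Function.update_self, Function.update_of_ne (hne hv')]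
        exact (hxadj v hv' h.symm).symm
      · rw [Function.update_of_ne (hne hw'), Function.update_of_ne (hne hv')]
        exact hfadj v hv' w hw' h
    · intro v hv
      simp only [mem_insert, not_or] at hv
      have key : ({y ∈ U | ∀ w ∈ insert a T, G.Adj v w → R.Adj y (Function.update f a x w)} :
          Finset α) = {y ∈ C v | G.Adj v a → R.Adj y x} := by
        ext y
        simp only [mem_filter, forall_mem_insert, Function.update_self, hC, and_assoc]
        refine and_congr_right fun _ => ?_
        rw [and_comm]
        refine and_congr_left fun _ => forall₂_congr fun w hw => ?_
        rw [Function.update_of_ne (hne hw)]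
      rw [key, filter_insert]
      split_ifs with hva
      · rw [card_insert_of_notMem (by simp [ha])]
        have h1 := hxbad v (by simp [hW, hva.symm, hv.2])
        have h2 : #(C v) ≤ q * #{y ∈ C v | R.Adj x y} := by
          by_contra hlt
          exact h1 (mem_filter.2 ⟨hxC, not_le.1 hlt⟩)
        have h3 : ({y ∈ C v | G.Adj v a → R.Adj y x} : Finset α) = {y ∈ C v | R.Adj x y} := by
          simp [hva, R.adj_comm]
        rw [h3, pow_succ, mul_assoc]
        exact (hcand v hv.2).trans (Nat.mul_le_mul_left _ h2)
      · have h3 : ({y ∈ C v | G.Adj v a → R.Adj y x} : Finset α) = C v := by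
          simp [hva]
        rw [h3]
        exact hcand v hv.2

/-- Contrapositive of the greedy embedding: if every two large subsets were dense to each other, all
of `G` could be embedded. -/
theorem exists_sparse_pair {V α : Type*} [Fintype V] (G : SimpleGraph V) (R : SimpleGraph α)
    (hfree : ¬ G.IsContained R) (U : Finset α) (q Δ : ℕ) (hq : 1 ≤ q) (hΔ : 1 ≤ Δ)
    (hG : ∀ v, #{w | G.Adj v w} ≤ Δ) (hU : 2 * q ^ Δ * Fintype.card V ≤ #U) :
    ∃ A ⊆ U, ∃ A' ⊆ U, #U ≤ 2 * Δ * q ^ Δ * #A ∧ #U ≤ 2 * Δ * q ^ Δ * #A' ∧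
      ∀ x ∈ A, q * #{y ∈ A' | R.Adj x y} < #A' := by
  by_contra! hcon
  obtain ⟨f, -, hinj, hadj, -⟩ := exists_partial_embedding G R U q Δ hq hΔ hG hU
    (fun A hA A' hA' h1 h2 => hcon A hA A' hA' h1 h2) univ
  exact hfree ⟨⟨⟨f, fun {v w} h => hadj v (mem_univ _) w (mem_univ _) h⟩,
    fun v w h => hinj (by simp) (by simp) h⟩⟩

/-- Markov's inequality in integer form. -/
theorem card_le_two_mul_card_filter {ι : Type*} (A : Finset ι) (g : ι → ℕ) (c : ℕ) (hc : 0 < c)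
    (h : ∑ x ∈ A, g x ≤ c * #A) : #A ≤ 2 * #{x ∈ A | g x ≤ 2 * c} := by
  have h1 := card_filter_add_card_filter_not (s := A) (fun x => g x ≤ 2 * c)
  have h2 : #{x ∈ A | ¬ g x ≤ 2 * c} * (2 * c) ≤ ∑ x ∈ A, g x := by
    rw [← smul_eq_mul]
    refine (card_nsmul_le_sum _ _ _ fun x hx => ?_).trans
      (sum_le_sum_of_subset (filter_subset (fun x => ¬ g x ≤ 2 * c) A))
    exact (not_le.1 (mem_filter.1 hx).2).le
  have h3 : 2 * #{x ∈ A | ¬ g x ≤ 2 * c} ≤ #A := by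
    refine le_of_mul_le_mul_left ?_ hc
    linarith
  omega

theorem sum_card_adj_comm {α : Type*} (R : SimpleGraph α) (A B : Finset α) :
    ∑ x ∈ A, #{y ∈ B | R.Adj x y} = ∑ y ∈ B, #{x ∈ A | R.Adj y x} := by
  have := sum_card_bipartiteAbove_eq_sum_card_bipartiteBelow (s := A) (t := B) R.Adj
  simp only [bipartiteAbove, bipartiteBelow] at this
  rw [this]
  simp only [R.adj_comm]

/-- Doubling: each round finds a sparse pair and recurses into both sides, so the result is a union
of `2 ^ s` blocks of size `m`. Inside blocks edges are counted trivially, which gives the term `q *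
2 ^ s`; between different blocks the density is of order `1 / q`, which gives `4 * 4 ^ s`. -/
theorem exists_few_edges {V α : Type*} [Fintype V] (G : SimpleGraph V) (R : SimpleGraph α)
    (hfree : ¬ G.IsContained R) (q Δ m : ℕ) (hq : 1 ≤ q) (hΔ : 1 ≤ Δ) (hm : 1 ≤ m)
    (hG : ∀ v, #{w | G.Adj v w} ≤ Δ) (hmV : 2 * q ^ Δ * Fintype.card V ≤ m) (s : ℕ)
    (U : Finset α) (hU : (4 * (2 * Δ * q ^ Δ)) ^ s * m ≤ #U) :
    ∃ B ⊆ U, #B = 2 ^ s * m ∧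
      q * ∑ x ∈ B, #{y ∈ B | R.Adj x y} ≤ (q * 2 ^ s + 4 * 4 ^ s) * m ^ 2 := by
  set S := 2 * Δ * q ^ Δ with hS
  have hqp : 0 < q ^ Δ := by positivity
  have hSpos : 1 ≤ S := by
    have : 0 < S := by positivity
    exact this
  induction s generalizing U with
  | zero =>
    obtain ⟨B, hB, hBc⟩ := exists_subset_card_eq (s := U) (n := m) (by simpa using hU)
    refine ⟨B, hB, by simpa using hBc, ?_⟩
    have : ∑ x ∈ B, #{y ∈ B | R.Adj x y} ≤ #B * #B := by
      rw [← smul_eq_mul]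
      exact sum_le_card_nsmul _ _ _ fun x _ => card_filter_le _ _
    rw [hBc] at this
    nlinarith [Nat.mul_le_mul_left q this]
  | succ s ih =>
    have hpow : 1 ≤ (4 * S) ^ s := Nat.one_le_pow _ _ (by omega)
    have hpow2 : 2 ^ s ≤ (4 * S) ^ s := Nat.pow_le_pow_left (by omega) _
    have hUm : m ≤ #U := le_trans (by
      have : 1 ≤ (4 * S) ^ (s + 1) := Nat.one_le_pow _ _ (by omega)
      nlinarith) hU
    obtain ⟨A, hA, A', hA', h1, h2, h3⟩ :=
      exists_sparse_pair G R hfree U q Δ hq hΔ hG (hmV.trans hUm)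
    rw [← hS] at h1 h2
    -- The spare factor 4 pays for two halvings of `A'`: deleting `B₁`, then keeping only vertices
    -- with few neighbours in `B₁`.
    have hbig : ∀ x : ℕ, #U ≤ S * x → 4 * ((4 * S) ^ s * m) ≤ x := by
      intro x hx
      refine le_of_mul_le_mul_left ?_ hSpos
      calc S * (4 * ((4 * S) ^ s * m)) = (4 * S) ^ (s + 1) * m := by ring
        _ ≤ #U := hU
        _ ≤ _ := hx
    have hAc := hbig _ h1
    have hAc' := hbig _ h2
    obtain ⟨B₁, hB₁, hB₁c, hB₁e⟩ := ih A (by omega)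
    have hB₁pos : 0 < #B₁ := by rw [hB₁c]; positivity
    have hB₁le : #B₁ ≤ (4 * S) ^ s * m := by rw [hB₁c]; exact Nat.mul_le_mul_right _ hpow2
    set A₂ := A' \ B₁ with hA₂
    have hA₂c : #A' ≤ 2 * #A₂ := by
      have : #A' - #B₁ ≤ #A₂ := le_card_sdiff B₁ A'
      omega
    have hsum : ∑ y ∈ A₂, q * #{x ∈ B₁ | R.Adj y x} ≤ (2 * #B₁) * #A₂ := by
      rw [← mul_sum, ← sum_card_adj_comm, mul_sum]
      calc ∑ x ∈ B₁, q * #{y ∈ A₂ | R.Adj x y} ≤ #B₁ • #A' := by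
            refine sum_le_card_nsmul _ _ _ fun x hx => le_trans ?_ (h3 x (hB₁ hx)).le
            exact Nat.mul_le_mul_left _
              (card_le_card (filter_subset_filter _ sdiff_subset))
        _ ≤ #B₁ * (2 * #A₂) := Nat.mul_le_mul_left _ hA₂c
        _ = _ := by ring
    have hmk := card_le_two_mul_card_filter A₂ _ _ (by positivity) hsum
    set A₃ := {y ∈ A₂ | q * #{x ∈ B₁ | R.Adj y x} ≤ 2 * (2 * #B₁)} with hA₃
    obtain ⟨B₂, hB₂, hB₂c, hB₂e⟩ := ih A₃ (by omega)
    have hA₃₂ : A₃ ⊆ A₂ := filter_subset _ _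
    have hdisj : Disjoint B₁ B₂ := by
      refine disjoint_left.2 fun x hx hx' => ?_
      exact (mem_sdiff.1 (hA₃₂ (hB₂ hx'))).2 hx
    refine ⟨B₁ ∪ B₂, union_subset (hB₁.trans hA)
      ((hB₂.trans hA₃₂).trans (sdiff_subset.trans hA')), ?_, ?_⟩
    · rw [card_union_of_disjoint hdisj, hB₁c, hB₂c]; ring
    · have hsplit : ∀ x, #{y ∈ B₁ ∪ B₂ | R.Adj x y} =
          #{y ∈ B₁ | R.Adj x y} + #{y ∈ B₂ | R.Adj x y} := by
        intro x
        rw [filter_union, card_union_of_disjoint (disjoint_filter_filter hdisj)]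
      have hcross : q * ∑ x ∈ B₂, #{y ∈ B₁ | R.Adj x y} ≤ #B₂ * (4 * #B₁) := by
        rw [mul_sum, ← smul_eq_mul (a := #B₂)]
        refine sum_le_card_nsmul _ _ _ fun x hx => ?_
        have := (mem_filter.1 (hB₂ hx)).2
        linarith
      rw [sum_union hdisj]
      simp only [hsplit, sum_add_distrib]
      rw [sum_card_adj_comm R B₁ B₂]
      rw [hB₁c, hB₂c] at hcross
      have e4 : (4 : ℕ) ^ s = 2 ^ s * 2 ^ s := by rw [← mul_pow]; norm_num
      have : (2 ^ s * m) * (4 * (2 ^ s * m)) = 4 * 4 ^ s * m ^ 2 := by rw [e4]; ring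
      rw [this] at hcross
      rw [pow_succ, pow_succ]
      nlinarith

/-- A graph without a copy of a bounded degree graph `G` has a large vertex set with small maximum
degree. -/
theorem exists_sparse_set {V α : Type*} [Fintype V] (G : SimpleGraph V) (R : SimpleGraph α)
    (hfree : ¬ G.IsContained R) (Δ m s : ℕ) (hΔ : 1 ≤ Δ) (hm : 1 ≤ m)
    (hG : ∀ v, #{w | G.Adj v w} ≤ Δ) (hmV : 2 * (2 ^ s) ^ Δ * Fintype.card V ≤ m)
    (U : Finset α) (hU : (4 * (2 * Δ * (2 ^ s) ^ Δ)) ^ s * m ≤ #U) :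
    ∃ B ⊆ U, 2 ^ s * m ≤ 2 * #B ∧ ∀ x ∈ B, #{y ∈ B | R.Adj x y} ≤ 10 * m := by
  obtain ⟨B, hB, hBc, hBe⟩ := exists_few_edges G R hfree (2 ^ s) Δ m Nat.one_le_two_pow hΔ hm hG
    hmV s U hU
  have e4 : (4 : ℕ) ^ s = 2 ^ s * 2 ^ s := by rw [← mul_pow]; norm_num
  -- With `q = 2 ^ s` the two terms of the edge bound balance, and the average degree is at most `5
  -- * m`.
  have hsum : ∑ x ∈ B, #{y ∈ B | R.Adj x y} ≤ (5 * m) * #B := by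
    refine le_of_mul_le_mul_left (a := 2 ^ s) ?_ (by positivity)
    rw [hBc]
    refine hBe.trans (le_of_eq ?_)
    rw [e4]; ring
  have := card_le_two_mul_card_filter B _ _ (by positivity) hsum
  refine ⟨{x ∈ B | #{y ∈ B | R.Adj x y} ≤ 2 * (5 * m)}, (filter_subset _ _).trans hB,
    by omega, fun x hx => ?_⟩
  refine (card_le_card (filter_subset_filter _ (filter_subset _ _))).trans
    ((mem_filter.1 hx).2.trans (by omega))

/-! ### Packing by switching -/

/-- A switching step: a vertex of `F` whose image lies in `B` and which is in conflict with one of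
its neighbours can be moved so that the set of conflicts gets strictly smaller. -/
theorem exists_fewer_conflicts {V α : Type*} [Fintype V] (F : SimpleGraph V) (Q : SimpleGraph α)
    (B L : Finset α) (T : Finset V) (Δ d β : ℕ) (hF : ∀ v, #{w | F.Adj v w} ≤ Δ)
    (hBL : Disjoint B L)
    (hT : ∀ x ∈ T, ∀ y ∈ T, x ≠ y → ¬ F.Adj x y ∧ ∀ z, F.Adj z x → ¬ F.Adj z y)
    (hB : ∀ b ∈ B, #{y ∈ B | Q.Adj b y} ≤ d) (hL : ∀ l ∈ L, β ≤ #{y ∈ B | ¬ Q.Adj l y})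
    (hβB : β ≤ #B) (hβ : Δ * d + (d + #L) * Δ + 1 < β)
    (φ : V → α) (hφ : Function.Injective φ) (hφBL : ∀ x, φ x ∈ B ∪ L) (hφT : ∀ x, φ x ∈ L → x ∈ T)
    (x y : V) (hxy : F.Adj x y) (hQ : Q.Adj (φ x) (φ y)) (hxB : φ x ∈ B) :
    ∃ ψ : V → α, Function.Injective ψ ∧ (∀ x, ψ x ∈ B ∪ L) ∧ (∀ x, ψ x ∈ L → x ∈ T) ∧
      #{e : V × V | F.Adj e.1 e.2 ∧ Q.Adj (ψ e.1) (ψ e.2)} <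
        #{e : V × V | F.Adj e.1 e.2 ∧ Q.Adj (φ e.1) (φ e.2)} := by
  -- New positions for `x` that create no conflict with neighbours placed in `L`. As `T` is spread
  -- out, `x` has at most one such neighbour, so a single bound `β` suffices.
  obtain ⟨P, hPB, hPβ, hP⟩ : ∃ P ⊆ B, β ≤ #P ∧
      ∀ y', F.Adj x y' → φ y' ∈ L → ∀ p ∈ P, ¬ Q.Adj p (φ y') := by
    by_cases h : ∃ y₀, F.Adj x y₀ ∧ φ y₀ ∈ L
    · obtain ⟨y₀, h1, h2⟩ := h
      refine ⟨_, filter_subset (fun p => ¬ Q.Adj (φ y₀) p) B, hL _ h2, fun y' h3 h4 p hp => ?_⟩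
      have : y' = y₀ := by
        by_contra hne
        exact (hT _ (hφT _ h4) _ (hφT _ h2) hne).2 x h3 h1
      rw [this, Q.adj_comm]
      exact (mem_filter.1 hp).2
    · exact ⟨B, subset_rfl, hβB, fun y' h1 h2 => (h ⟨y', h1, h2⟩).elim⟩
  set bad₁ : Finset α :=
    ({y' | F.Adj x y' ∧ φ y' ∈ B} : Finset V).biUnion fun y' => {p ∈ B | Q.Adj (φ y') p}
    with hbad₁
  set Z : Finset V := {z | Q.Adj (φ x) (φ z)} with hZ
  set bad₂ : Finset α := Z.biUnion fun z => ({w | F.Adj z w} : Finset V).image φ with hbad₂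
  have hc₁ : #bad₁ ≤ Δ * d := by
    refine (card_biUnion_le_card_mul _ _ d fun y' hy' => hB _ ?_).trans
      (Nat.mul_le_mul_right _ (le_trans (card_le_card fun w hw => ?_) (hF x)))
    · exact (mem_filter.1 hy').2.2
    · simp only [mem_filter, mem_univ, true_and] at hw ⊢
      exact hw.1
  have hZc : #Z ≤ d + #L := by
    rw [← card_image_of_injective Z hφ]
    refine (card_le_card (t := {y ∈ B | Q.Adj (φ x) y} ∪ L) fun p hp => ?_).trans
      ((card_union_le _ _).trans (Nat.add_le_add_right (hB _ hxB) _))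
    obtain ⟨z, hz, rfl⟩ := mem_image.1 hp
    have := hφBL z
    simp only [hZ, mem_filter, mem_univ, true_and, mem_union] at hz this ⊢
    tauto
  have hc₂ : #bad₂ ≤ (d + #L) * Δ :=
    (card_biUnion_le_card_mul _ _ Δ fun z _ => card_image_le.trans (hF z)).trans
      (Nat.mul_le_mul_right _ hZc)
  -- `bad₁` guards the edges at `x` after the swap, `bad₂` those at the vertex displaced from `p`.
  -- Also `φ y` is excluded: swapping `x` with `y` would keep their conflict.
  have hcard : #((bad₁ ∪ bad₂) ∪ {φ y}) < #P := by
    have h1 := card_union_le (bad₁ ∪ bad₂) {φ y}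
    have h2 := card_union_le bad₁ bad₂
    rw [card_singleton] at h1
    omega
  obtain ⟨p, hpP, hp⟩ := exists_mem_notMem_of_card_lt_card hcard
  simp only [mem_union, mem_singleton, not_or] at hp
  obtain ⟨⟨hp₁, hp₂⟩, hpy⟩ := hp
  have key₁ : ∀ y', F.Adj x y' → ¬ Q.Adj p (φ y') := by
    intro y' h hq
    rcases mem_union.1 (hφBL y') with h' | h'
    · exact hp₁ (mem_biUnion.2 ⟨y', by simp [h, h'], by simp [hPB hpP, hq.symm]⟩)
    · exact hP y' h h' p hpP hq
  have key₂ : ∀ z z', φ z = p → F.Adj z z' → ¬ Q.Adj (φ x) (φ z') := by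
    intro z z' hz h hq
    exact hp₂ (mem_biUnion.2 ⟨z', by simp [hZ, hq],
      mem_image.2 ⟨z, by simp [h.symm], hz⟩⟩)
  set ψ : V → α := fun v => Equiv.swap (φ x) p (φ v) with hψ
  have hψx : ψ x = p := Equiv.swap_apply_left _ _
  have hψp : ∀ z, φ z = p → ψ z = φ x := fun z hz => by
    simp only [hψ, hz, Equiv.swap_apply_right]
  have hψo : ∀ z, z ≠ x → φ z ≠ p → ψ z = φ z := fun z h1 h2 =>
    Equiv.swap_apply_of_ne_of_ne (fun h => h1 (hφ h)) h2
  have hpBd : p ∉ L := disjoint_left.1 hBL (hPB hpP)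
  have hxBd : φ x ∉ L := disjoint_left.1 hBL hxB
  refine ⟨ψ, (Equiv.swap (φ x) p).injective.comp hφ, fun z => ?_, fun z hz => ?_, ?_⟩
  · by_cases h1 : z = x
    · rw [h1, hψx]; exact mem_union_left _ (hPB hpP)
    · by_cases h2 : φ z = p
      · rw [hψp z h2]; exact mem_union_left _ hxB
      · rw [hψo z h1 h2]; exact hφBL z
  · by_cases h1 : z = x
    · rw [h1, hψx] at hz; exact absurd hz hpBd
    · by_cases h2 : φ z = p
      · rw [hψp z h2] at hz; exact absurd hz hxBd
      · rw [hψo z h1 h2] at hz; exact hφT z hz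
  · refine card_lt_card (ssubset_iff_of_subset ?_ |>.2 ⟨(x, y), ?_, ?_⟩)
    · rintro ⟨u, v⟩ he
      simp only [mem_filter, mem_univ, true_and] at he ⊢
      obtain ⟨huv, hq⟩ := he
      refine ⟨huv, ?_⟩
      by_cases hu : u = x
      · subst hu
        rw [hψx] at hq
        by_cases hv : φ v = p
        · rw [hψp v hv] at hq
          rw [hv]; exact hq.symm
        · rw [hψo v huv.ne.symm hv] at hq
          exact absurd hq (key₁ v huv)
      · by_cases hv : v = x
        · subst hv
          rw [hψx] at hq
          by_cases hup : φ u = p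
          · rw [hψp u hup] at hq
            rw [hup]; exact hq.symm
          · rw [hψo u hu hup] at hq
            exact absurd hq.symm (key₁ u huv.symm)
        · by_cases hup : φ u = p
          · have hvp : φ v ≠ p := fun h => huv.ne (hφ (hup.trans h.symm))
            rw [hψp u hup, hψo v hv hvp] at hq
            exact absurd hq (key₂ u v hup huv)
          · rw [hψo u hu hup] at hq
            by_cases hvp : φ v = p
            · rw [hψp v hvp] at hq
              exact absurd hq.symm (key₂ v u hvp huv.symm)
            · rwa [hψo v hv hvp] at hq
    · simp [hxy, hQ]
    · simp only [mem_filter, mem_univ, true_and, not_and]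
      intro _
      rw [hψx, hψo y hxy.ne.symm (fun h => hpy h.symm)]
      exact key₁ y hxy

/-- A packing theorem in the spirit of Sauer and Spencer: a graph `F` of small maximum degree is
embedded edge-disjointly from `Q` into `B ∪ L`, where `Q` has small maximum degree on `B` and the
few vertices of `L` are far from `Q`-complete to `B`. -/
theorem exists_packing_of_injective {V α : Type*} [Fintype V] (F : SimpleGraph V)
    (Q : SimpleGraph α)
    (B L : Finset α) (T : Finset V) (Δ d β : ℕ) (hF : ∀ v, #{w | F.Adj v w} ≤ Δ)
    (hBL : Disjoint B L)
    (hT : ∀ x ∈ T, ∀ y ∈ T, x ≠ y → ¬ F.Adj x y ∧ ∀ z, F.Adj z x → ¬ F.Adj z y)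
    (hB : ∀ b ∈ B, #{y ∈ B | Q.Adj b y} ≤ d) (hL : ∀ l ∈ L, β ≤ #{y ∈ B | ¬ Q.Adj l y})
    (hβB : β ≤ #B) (hβ : Δ * d + (d + #L) * Δ + 1 < β)
    (φ : V → α) (hφ : Function.Injective φ) (hφBL : ∀ x, φ x ∈ B ∪ L)
    (hφT : ∀ x, φ x ∈ L → x ∈ T) :
    ∃ ψ : V → α, Function.Injective ψ ∧ (∀ x, ψ x ∈ B ∪ L) ∧
      ∀ x y, F.Adj x y → ¬ Q.Adj (ψ x) (ψ y) := by
  induction hn : #{e : V × V | F.Adj e.1 e.2 ∧ Q.Adj (φ e.1) (φ e.2)} using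
    Nat.strong_induction_on generalizing φ with
  | _ n ih =>
    by_cases hgood : ∀ x y, F.Adj x y → ¬ Q.Adj (φ x) (φ y)
    · exact ⟨φ, hφ, hφBL, hgood⟩
    push Not at hgood
    obtain ⟨x, y, hxy, hQ⟩ := hgood
    -- Vertices placed in `L` belong to the independent set `T`, so some end of the conflict lies in
    -- `B` and can be moved.
    obtain ⟨u, v, huv, hQ', huB⟩ : ∃ u v, F.Adj u v ∧ Q.Adj (φ u) (φ v) ∧ φ u ∈ B := by
      rcases mem_union.1 (hφBL x) with hx | hx
      · exact ⟨x, y, hxy, hQ, hx⟩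
      rcases mem_union.1 (hφBL y) with hy | hy
      · exact ⟨y, x, hxy.symm, hQ.symm, hy⟩
      exact absurd hxy (hT _ (hφT x hx) _ (hφT y hy) hxy.ne).1
    obtain ⟨ψ, h1, h2, h3, h4⟩ := exists_fewer_conflicts F Q B L T Δ d β hF hBL hT hB hL hβB hβ φ
      hφ hφBL hφT u v huv hQ' huB
    exact ih _ (hn ▸ h4) ψ h1 h2 h3 rfl

/-- For a maximal set with pairwise distances at least three, the balls of radius two cover all
vertices. -/
theorem exists_distance_three_set {V : Type*} [Fintype V] (F : SimpleGraph V) (Δ : ℕ)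
    (hF : ∀ v, #{w | F.Adj v w} ≤ Δ) :
    ∃ T : Finset V, (∀ x ∈ T, ∀ y ∈ T, x ≠ y → ¬ F.Adj x y ∧ ∀ z, F.Adj z x → ¬ F.Adj z y) ∧
      Fintype.card V ≤ #T * (1 + Δ + Δ * Δ) := by
  set N : V → Finset V := fun v => {w | F.Adj v w} with hN
  obtain ⟨T, hT⟩ := (Set.toFinite {T : Finset V | ∀ x ∈ T, ∀ y ∈ T, x ≠ y →
    ¬ F.Adj x y ∧ ∀ z, F.Adj z x → ¬ F.Adj z y}).exists_maximal ⟨∅, by simp⟩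
  refine ⟨T, hT.prop, ?_⟩
  have hcov : (univ : Finset V) ⊆ T.biUnion fun t => {t} ∪ N t ∪ (N t).biUnion N := by
    intro v _
    by_contra hv
    simp only [mem_biUnion, mem_union, mem_singleton, not_exists, not_and, not_or, hN, mem_filter,
      mem_univ, true_and] at hv
    have hvT : v ∉ T := fun h => (hv v h).1.1 rfl
    refine hvT (hT.le_of_ge (y := insert v T) ?_ (subset_insert _ _) (mem_insert_self _ _))
    intro x hx y hy hxy
    rcases mem_insert.1 hx with rfl | hx' <;> rcases mem_insert.1 hy with rfl | hy'
    · exact absurd rfl hxy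
    · exact ⟨fun h => (hv y hy').1.2 h.symm, fun z h1 h2 => (hv y hy').2 z h2.symm h1⟩
    · exact ⟨(hv x hx').1.2, fun z h1 h2 => (hv x hx').2 z h1.symm h2⟩
    · exact hT.prop x hx' y hy' hxy
  rw [← card_univ]
  refine (card_le_card hcov).trans (card_biUnion_le_card_mul _ _ _ fun t _ => ?_)
  refine (card_union_le _ _).trans (Nat.add_le_add ((card_union_le _ _).trans
    (Nat.add_le_add (card_singleton _).le (hF t))) ?_)
  exact (card_biUnion_le_card_mul _ _ Δ fun z _ => hF z).trans (Nat.mul_le_mul_right _ (hF t))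

/-- Supplies a starting placement for the switching. If `B` alone has room, `L` is left empty;
otherwise `F` is so large that a spread-out set can fill all of `L`. -/
theorem exists_packing {V α : Type*} [Fintype V] (F : SimpleGraph V) (Q : SimpleGraph α)
    (B L : Finset α) (Δ d β : ℕ) (hF : ∀ v, #{w | F.Adj v w} ≤ Δ) (hBL : Disjoint B L)
    (hB : ∀ b ∈ B, #{y ∈ B | Q.Adj b y} ≤ d) (hL : ∀ l ∈ L, β ≤ #{y ∈ B | ¬ Q.Adj l y})
    (hβB : β ≤ #B) (hβ : Δ * d + (d + #L) * Δ + 1 < β) (hcard : Fintype.card V ≤ #B + #L)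
    (hLB : #L * (1 + Δ + Δ * Δ) ≤ #B) :
    ∃ ψ : V → α, Function.Injective ψ ∧ (∀ x, ψ x ∈ B ∪ L) ∧
      ∀ x y, F.Adj x y → ¬ Q.Adj (ψ x) (ψ y) := by
  by_cases hVB : Fintype.card V ≤ #B
  · obtain ⟨f⟩ : Nonempty (V ↪ B) := Function.Embedding.nonempty_of_card_le (by simpa using hVB)
    refine exists_packing_of_injective F Q B L ∅ Δ d β hF hBL (by simp) hB hL hβB hβ
      (fun v => f v) (Subtype.val_injective.comp f.injective)
      (fun x => mem_union_left _ (f x).2) fun x hx => ?_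
    exact absurd hx (disjoint_left.1 hBL (f x).2)
  obtain ⟨T, hT, hTc⟩ := exists_distance_three_set F Δ hF
  have hLT : #L ≤ #T := by
    refine le_of_mul_le_mul_right (a := 1 + Δ + Δ * Δ) ?_ (by omega)
    omega
  obtain ⟨T', hT', hTc'⟩ := exists_subset_card_eq hLT
  obtain ⟨f⟩ : Nonempty ((T'ᶜ : Finset V) ↪ B) := Function.Embedding.nonempty_of_card_le (by
    rw [Fintype.card_coe, Fintype.card_coe, card_compl]; omega)
  obtain ⟨g⟩ : Nonempty (T' ↪ L) := Function.Embedding.nonempty_of_card_le (by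
    rw [Fintype.card_coe, Fintype.card_coe, hTc'])
  set φ : V → α := fun v => if h : v ∈ T' then g ⟨v, h⟩ else f ⟨v, mem_compl.2 h⟩ with hφ
  have h1 : ∀ v (h : v ∈ T'), φ v = g ⟨v, h⟩ := fun v h => dif_pos h
  have h2 : ∀ v (h : v ∉ T'), φ v = f ⟨v, mem_compl.2 h⟩ := fun v h => dif_neg h
  have h1L : ∀ v, v ∈ T' → φ v ∈ L := fun v h => h1 v h ▸ (g _).2
  have h2B : ∀ v, v ∉ T' → φ v ∈ B := fun v h => h2 v h ▸ (f _).2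
  refine exists_packing_of_injective F Q B L T Δ d β hF hBL hT hB hL hβB hβ φ ?_ ?_ ?_
  · intro v w h
    by_cases hv : v ∈ T' <;> by_cases hw : w ∈ T'
    · rw [h1 v hv, h1 w hw] at h
      simpa using g.injective (Subtype.val_injective h)
    · exact absurd (h ▸ h1L v hv) (disjoint_left.1 hBL (h2B w hw))
    · exact absurd (h1L w hw) (disjoint_left.1 hBL (h ▸ h2B v hv))
    · rw [h2 v hv, h2 w hw] at h
      simpa using f.injective (Subtype.val_injective h)
  · intro v
    by_cases hv : v ∈ T'
    · exact mem_union_right _ (h1L v hv)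
    · exact mem_union_left _ (h2B v hv)
  · intro v hvL
    by_contra hv
    exact disjoint_left.1 hBL (h2B v fun h => hv (hT' h)) hvL

/-! ### Copies and tilings inside vertex sets -/

/-- `R` contains a copy of `H` with all vertices in `U`. -/
def HasCopyIn {W α : Type*} (H : SimpleGraph W) (R : SimpleGraph α) (U : Finset α) : Prop :=
  ∃ g : W → α, Function.Injective g ∧ (∀ w, g w ∈ U) ∧ ∀ a b, H.Adj a b → R.Adj (g a) (g b)

/-- `Y` is the vertex set of `j` disjoint copies of `H` in `R`. -/
def Tiles {W α : Type*} [Fintype W] (H : SimpleGraph W) (R : SimpleGraph α) (Y : Finset α)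
    (j : ℕ) : Prop :=
  ∃ f : Fin j × W → α, Function.Injective f ∧
    (∀ p q, (disjointCopies j H).Adj p q → R.Adj (f p) (f q)) ∧ univ.image f = Y

theorem HasCopyIn.mono {W α : Type*} {H : SimpleGraph W} {R : SimpleGraph α} {U U' : Finset α}
    (h : HasCopyIn H R U) (hU : U ⊆ U') : HasCopyIn H R U' := by
  obtain ⟨g, h1, h2, h3⟩ := h
  exact ⟨g, h1, fun w => hU (h2 w), h3⟩

theorem HasCopyIn.isContained {W α : Type*} {H : SimpleGraph W} {R : SimpleGraph α} {U : Finset α}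
    (h : HasCopyIn H R U) : H.IsContained R := by
  obtain ⟨g, h1, -, h3⟩ := h
  exact ⟨⟨⟨g, fun {a b} h => h3 a b h⟩, h1⟩⟩

section Tiles
variable {W α : Type*} [Fintype W] {H : SimpleGraph W} {R : SimpleGraph α}

theorem Tiles.card {Y : Finset α} {j : ℕ} (h : Tiles H R Y j) : #Y = j * Fintype.card W := by
  obtain ⟨f, h1, -, rfl⟩ := h
  rw [card_image_of_injective _ h1]
  simp

theorem tiles_empty : Tiles H R ∅ 0 :=
  ⟨fun p => p.1.elim0, fun p => p.1.elim0, fun p => p.1.elim0, by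
    ext x; simp⟩

theorem Tiles.union {Y Z : Finset α} {i j : ℕ} (hY : Tiles H R Y i) (hZ : Tiles H R Z j)
    (hYZ : Disjoint Y Z) : Tiles H R (Y ∪ Z) (i + j) := by
  obtain ⟨f, hf, hfa, rfl⟩ := hY
  obtain ⟨g, hg, hga, rfl⟩ := hZ
  have hne : ∀ p q, f p ≠ g q := fun p q h =>
    disjoint_left.1 hYZ (mem_image_of_mem f (mem_univ p)) (h ▸ mem_image_of_mem g (mem_univ q))
  refine ⟨fun p => Fin.addCases (fun a => f (a, p.2)) (fun b => g (b, p.2)) p.1, ?_, ?_, ?_⟩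
  · rintro ⟨a, w⟩ ⟨b, w'⟩ h
    induction a using Fin.addCases <;> induction b using Fin.addCases <;>
      simp only [Fin.addCases_left, Fin.addCases_right] at h
    · have := hf h; simp_all
    · exact absurd h (hne _ _)
    · exact absurd h.symm (hne _ _)
    · have := hg h; simp_all
  · rintro ⟨a, w⟩ ⟨b, w'⟩ ⟨h, h'⟩
    obtain rfl : a = b := h
    induction a using Fin.addCases <;> simp only [Fin.addCases_left, Fin.addCases_right]
    · exact hfa _ _ ⟨rfl, h'⟩
    · exact hga _ _ ⟨rfl, h'⟩
  · ext x
    simp only [mem_image, mem_union, mem_univ, true_and, Prod.exists]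
    constructor
    · rintro ⟨a, w, h⟩
      induction a using Fin.addCases <;> simp only [Fin.addCases_left, Fin.addCases_right] at h
      · exact Or.inl ⟨_, _, h⟩
      · exact Or.inr ⟨_, _, h⟩
    · rintro (⟨a, w, h⟩ | ⟨a, w, h⟩)
      · exact ⟨Fin.castAdd j a, w, by simpa using h⟩
      · exact ⟨Fin.natAdd i a, w, by simpa using h⟩

theorem tiles_image {g : W → α} (hg : Function.Injective g)
    (h : ∀ a b, H.Adj a b → R.Adj (g a) (g b)) : Tiles H R (univ.image g) 1 := by
  refine ⟨fun p => g p.2, ?_, fun p q hpq => h _ _ hpq.2, ?_⟩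
  · rintro ⟨a, w⟩ ⟨b, w'⟩ h
    have : w = w' := hg h
    simp [this, Subsingleton.elim a b]
  · ext x; simp

theorem Tiles.isContained {Y : Finset α} {n j : ℕ} (h : Tiles H R Y j) (hn : n ≤ j) :
    (disjointCopies n H).IsContained R := by
  obtain ⟨f, h1, h2, -⟩ := h
  refine ⟨⟨⟨fun p => f (Fin.castLE hn p.1, p.2), fun {p q} hpq => h2 _ _ ⟨?_, hpq.2⟩⟩, ?_⟩⟩
  · rw [hpq.1]
  · rintro ⟨a, w⟩ ⟨b, w'⟩ h
    have := h1 h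
    simpa using this

/-- Greedily removing copies of `H` from a vertex set. -/
theorem exists_tiles [Nonempty W] (t : ℕ) (U : Finset α)
    (h : ∀ U' ⊆ U, t ≤ #U' → HasCopyIn H R U') :
    ∃ Y ⊆ U, ∃ j, Tiles H R Y j ∧ #(U \ Y) < t := by
  induction hn : #U using Nat.strong_induction_on generalizing U with
  | _ n ih =>
    by_cases ht : #U < t
    · exact ⟨∅, by simp, 0, tiles_empty, by simpa⟩
    obtain ⟨g, hg, hgU, hga⟩ := h U subset_rfl (not_lt.1 ht)
    set Z := univ.image g with hZ
    have hZU : Z ⊆ U := by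
      intro x hx
      obtain ⟨w, -, rfl⟩ := mem_image.1 hx
      exact hgU w
    have hZpos : 0 < #Z := by
      rw [hZ, card_image_of_injective _ hg]
      exact Fintype.card_pos
    have hlt : #(U \ Z) < n := by
      have := card_sdiff_add_card_eq_card hZU
      omega
    obtain ⟨Y, hY, j, hT, hj⟩ := ih _ hlt (U \ Z)
      (fun U' hU' => h U' (hU'.trans sdiff_subset)) rfl
    refine ⟨Z ∪ Y, union_subset hZU (hY.trans sdiff_subset), 1 + j,
      (tiles_image hg hga).union hT ?_, ?_⟩
    · exact disjoint_left.2 fun x hx hx' => (mem_sdiff.1 (hY hx')).2 hx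
    · rwa [← sup_eq_union, ← sdiff_sdiff_left]
end Tiles

/-! ### The upper bound for large `n` -/

/-- The off-diagonal Ramsey bound for bounded degree graphs, inside a vertex set. -/
theorem hasCopyIn_compl_of_free {V W α : Type*} [Fintype V] [Fintype W] (G : SimpleGraph V)
    (H : SimpleGraph W) (R : SimpleGraph α) (hfree : ¬ G.IsContained R) (Δ m s : ℕ) (hΔ : 1 ≤ Δ)
    (hm : 1 ≤ m) (hG : ∀ v, #{w | G.Adj v w} ≤ Δ) (hH : ∀ v, #{w | H.Adj v w} ≤ Δ)
    (hs : 128 * Δ ^ 2 ≤ 2 ^ s)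
    (hmV : 2 * (2 ^ s) ^ Δ * Fintype.card V ≤ m) (hmW : Fintype.card W ≤ m)
    (U : Finset α) (hU : (4 * (2 * Δ * (2 ^ s) ^ Δ)) ^ s * m ≤ #U) : HasCopyIn H Rᶜ U := by
  obtain ⟨B, hBU, hBc, hBd⟩ := exists_sparse_set G R hfree Δ m s hΔ hm hG hmV U hU
  have h1 : 64 * Δ ^ 2 * m ≤ #B := by
    have := Nat.mul_le_mul_right m hs
    linarith
  have h2 : Δ * m ≤ Δ ^ 2 * m := Nat.mul_le_mul_right _ (by nlinarith)
  have h3 : m ≤ Δ * m := Nat.le_mul_of_pos_left _ hΔ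
  -- With no exceptional vertices the packing condition only asks that `#B` exceed about twice `Δ`
  -- times the degree bound `10 * m`.
  obtain ⟨ψ, hψ, hψB, hψa⟩ := exists_packing H R B ∅ Δ (10 * m) #B hH (disjoint_empty_right _) hBd
    (by simp) le_rfl (by simp only [card_empty]; nlinarith) (by simp only [card_empty]; linarith)
    (by simp)
  exact ⟨ψ, hψ, fun w => hBU (by simpa using hψB w), fun a b hab =>
    ⟨hψ.ne hab.ne, hψa a b hab⟩⟩

/-- A copy of a member of `𝒟(G)` on vertices that are almost complete to `B` extends to a copy
of `G`. -/
theorem isContained_of_derivedFamily {V α : Type*} [Fintype V] (G : SimpleGraph V)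
    (R : SimpleGraph α) (Δ : ℕ) (hΔ : 1 ≤ Δ) (hG : ∀ v, #{w | G.Adj v w} ≤ Δ) (B E : Finset α)
    (hBE : Disjoint B E) (hB : 2 * Fintype.card V ≤ #B)
    (hE : ∀ v ∈ E, #{y ∈ B | ¬ R.Adj v y} * (2 * Δ) ≤ #B) (S : MaxIndepSet G)
    (h : HasCopyIn (derivedFamily G S) R E) : G.IsContained R := by
  obtain ⟨f, hf, hfE, hfa⟩ := h
  set M : ↥S.1 → Finset α := fun v => {y ∈ B | ∀ u : ↥(S.1ᶜ), G.Adj v u → R.Adj (f u) y} with hM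
  have hMB : ∀ v, M v ⊆ B := fun v => filter_subset _ _
  -- At most `Δ` neighbours of `v` lie outside `S`, and each excludes at most a fraction `1 / (2 *
  -- Δ)` of `B`; half of `B` remains. Hall's condition is then immediate.
  have hMc : ∀ v, Fintype.card V ≤ #(M v) := by
    intro v
    have hsub : B ⊆ M v ∪ ({u : ↥(S.1ᶜ) | G.Adj v u} : Finset _).biUnion
        fun u => {y ∈ B | ¬ R.Adj (f u) y} := by
      intro y hy
      by_cases hyM : y ∈ M v
      · exact mem_union_left _ hyM
      · simp only [hM, mem_filter, hy, true_and, not_forall] at hyM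
        obtain ⟨u, hu, hyu⟩ := hyM
        exact mem_union_right _ (mem_biUnion.2 ⟨u, by simp [hu], by simp [hy, hyu]⟩)
    have h1 := (card_le_card hsub).trans (card_union_le _ _)
    have h2 := card_biUnion_le_card_mul ({u : ↥(S.1ᶜ) | G.Adj v u} : Finset _)
      (fun u => {y ∈ B | ¬ R.Adj (f u) y}) (#B / (2 * Δ)) fun u _ => by
        rw [Nat.le_div_iff_mul_le (by omega)]
        exact hE _ (hfE u)
    have h3 : #({u : ↥(S.1ᶜ) | G.Adj v u} : Finset _) ≤ Δ := by
      refine le_trans ?_ (hG v)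
      exact card_le_card_of_injOn (fun u => u.1) (fun u hu => by simpa using hu)
        (Subtype.val_injective.injOn)
    have h4 : #B / (2 * Δ) * (2 * Δ) ≤ #B := Nat.div_mul_le_self _ _
    have h5 := Nat.mul_le_mul_right (#B / (2 * Δ)) h3
    have h6 : 2 * (Δ * (#B / (2 * Δ))) ≤ #B := by linarith
    omega
  obtain ⟨g, hg, hgM⟩ := (all_card_le_biUnion_card_iff_exists_injective M).1 fun s => by
    rcases s.eq_empty_or_nonempty with rfl | ⟨v, hv⟩
    · simp
    · calc #s = #(s.map (Function.Embedding.subtype _)) := (card_map _).symm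
        _ ≤ Fintype.card V := card_le_univ _
        _ ≤ #(M v) := hMc v
        _ ≤ _ := card_le_card (subset_biUnion_of_mem M hv)
  have hfg : ∀ u v, f u ≠ g v := fun u v h =>
    disjoint_left.1 hBE (hMB _ (hgM v)) (h ▸ hfE u)
  have hfgR : ∀ (u : ↥(S.1ᶜ)) (v : ↥S.1), G.Adj v u → R.Adj (f u) (g v) := fun u v h =>
    (mem_filter.1 (hgM v)).2 u h
  set φ : V → α := fun v => if h : v ∈ S.1 then g ⟨v, h⟩ else f ⟨v, h⟩ with hφ
  have h1 : ∀ v (h : v ∈ S.1), φ v = g ⟨v, h⟩ := fun v h => dif_pos h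
  have h2 : ∀ v (h : v ∉ S.1), φ v = f ⟨v, h⟩ := fun v h => dif_neg h
  refine ⟨⟨⟨φ, fun {v w} hvw => ?_⟩, fun v w hvw => ?_⟩⟩
  · by_cases hv : v ∈ S.1 <;> by_cases hw : w ∈ S.1
    · exact absurd hvw (S.2.prop hv hw hvw.ne)
    · rw [h1 v hv, h2 w hw]; exact (hfgR ⟨w, hw⟩ ⟨v, hv⟩ hvw).symm
    · rw [h1 w hw, h2 v hv]; exact hfgR ⟨v, hv⟩ ⟨w, hw⟩ hvw.symm
    · rw [h2 v hv, h2 w hw]; exact hfa ⟨v, hv⟩ ⟨w, hw⟩ hvw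
  · change φ v = φ w at hvw
    by_cases hv : v ∈ S.1 <;> by_cases hw : w ∈ S.1
    · rw [h1 v hv, h1 w hw] at hvw; simpa using hg hvw
    · rw [h1 v hv, h2 w hw] at hvw; exact absurd hvw.symm (hfg _ _)
    · rw [h1 w hw, h2 v hv] at hvw; exact absurd hvw (hfg _ _)
    · rw [h2 v hv, h2 w hw] at hvw; simpa using hf hvw

theorem card_adj_disjointCopies_le {W : Type*} [Fintype W] (H : SimpleGraph W) (Δ n : ℕ)
    (hH : ∀ v, #{w | H.Adj v w} ≤ Δ) (p : Fin n × W) :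
    #{q | (disjointCopies n H).Adj p q} ≤ Δ := by
  refine le_trans (card_le_card_of_injOn (fun q => q.2) (fun q hq => ?_) ?_) (hH p.2)
  · simp only [coe_filter, mem_univ, true_and, Set.mem_ofPred_eq] at hq ⊢
    exact hq.2
  · intro q hq q' hq' h
    simp only [coe_filter, mem_univ, true_and, Set.mem_ofPred_eq] at hq hq'
    exact Prod.ext (hq.1.symm.trans hq'.1) h

/-- Exact tiling of a set of small maximum degree together with a few vertices that are not almost
complete to it. -/
theorem exists_tiles_compl_of_sparse {W α : Type*} [Fintype W] (H : SimpleGraph W)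
    (R : SimpleGraph α) (B L : Finset α) (Δ m j : ℕ) (hΔ : 1 ≤ Δ) (hH : ∀ v, #{w | H.Adj v w} ≤ Δ)
    (hBL : Disjoint B L) (hB : 64 * Δ ^ 2 * m ≤ #B) (hBd : ∀ x ∈ B, #{y ∈ B | R.Adj x y} ≤ 10 * m)
    (hL : ∀ l ∈ L, #B < #{y ∈ B | ¬ R.Adj l y} * (2 * Δ)) (hLm : #L < m)
    (hj : j * Fintype.card W ≤ #B + #L) : ∃ Y ⊆ B ∪ L, Tiles H Rᶜ Y j := by
  have hΔ1 : Δ * m ≤ Δ ^ 2 * m := Nat.mul_le_mul_right _ (by nlinarith)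
  have hΔ2 : m ≤ Δ * m := Nat.le_mul_of_pos_left _ hΔ
  -- Switching forbids at most `21 * Δ * m` positions, as `#L < m`.
  have hβ : 32 * Δ * m ≤ #B / (2 * Δ) := by
    rw [Nat.le_div_iff_mul_le (by omega)]
    nlinarith
  have hLβ : ∀ l ∈ L, #B / (2 * Δ) ≤ #{y ∈ B | ¬ R.Adj l y} := fun l hl =>
    Nat.div_le_of_le_mul (by linarith [hL l hl])
  have hΔL : Δ * (#L + 1) ≤ Δ * m := Nat.mul_le_mul_left _ hLm
  have hΔL2 : Δ ^ 2 * #L ≤ Δ ^ 2 * m := Nat.mul_le_mul_left _ hLm.le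
  obtain ⟨ψ, hψ, hψB, hψa⟩ := exists_packing (disjointCopies j H) R B L Δ (10 * m) (#B / (2 * Δ))
    (card_adj_disjointCopies_le H Δ j hH) hBL hBd hLβ (Nat.div_le_self _ _)
    (by linarith) (by simpa using hj) (by linarith)
  refine ⟨univ.image ψ, fun x hx => ?_, ψ, hψ, fun p q h => ⟨hψ.ne h.ne, hψa p q h⟩, rfl⟩
  obtain ⟨p, -, rfl⟩ := mem_image.1 hx
  exact hψB p

/-- Combines three tilings: greedy outside `B`, greedy in the part `E` almost complete to `B`, and
by packing in `B` and the remaining vertices. Only the leftover of `E`, fewer than `r` vertices, is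
unavailable to the last tiling. -/
theorem disjointCopies_isContained_compl {V W α : Type*} [Fintype V] [Fintype W] [Nonempty W]
    [Fintype α]
    (G : SimpleGraph V) (H : SimpleGraph W) (R : SimpleGraph α) (hfree : ¬ G.IsContained R)
    (Δ m s r n : ℕ) (hΔ : 1 ≤ Δ) (hm : 1 ≤ m)
    (hG : ∀ v, #{w | G.Adj v w} ≤ Δ) (hH : ∀ v, #{w | H.Adj v w} ≤ Δ)
    (hs : 128 * Δ ^ 2 ≤ 2 ^ s)
    (hmV : 2 * (2 ^ s) ^ Δ * Fintype.card V ≤ m) (hmW : Fintype.card W ≤ m)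
    (hr : ∀ E : Finset α, r ≤ #E →
      (∃ S, HasCopyIn (derivedFamily G S) R E) ∨ HasCopyIn H Rᶜ E)
    (hα : (4 * (2 * Δ * (2 ^ s) ^ Δ)) ^ s * ((4 * (2 * Δ * (2 ^ s) ^ Δ)) ^ s * m) ≤
      Fintype.card α)
    (hn : n * Fintype.card W + r ≤ Fintype.card α + 1) :
    (disjointCopies n H).IsContained Rᶜ := by
  have hSpos : 0 < (4 * (2 * Δ * (2 ^ s) ^ Δ)) ^ s := by positivity
  -- Two scales: any `m₁` vertices contain a copy of `H` in `Rᶜ`, so `m₁` bounds the greedy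
  -- leftover; `B` is then built at scale `m₁` so as to dominate that leftover.
  obtain ⟨m₁, hm₁⟩ : ∃ m₁, m₁ = (4 * (2 * Δ * (2 ^ s) ^ Δ)) ^ s * m := ⟨_, rfl⟩
  rw [← hm₁] at hα
  have hmm₁ : m ≤ m₁ := hm₁ ▸ Nat.le_mul_of_pos_left _ hSpos
  obtain ⟨B, -, hBc, hBd⟩ := exists_sparse_set G R hfree Δ m₁ s hΔ (hm.trans hmm₁) hG
    (hmV.trans hmm₁) univ (by rwa [card_univ])
  have hB1 : 64 * Δ ^ 2 * m₁ ≤ #B := by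
    have := Nat.mul_le_mul_right m₁ hs
    linarith
  have hΔ1 : Δ * m₁ ≤ Δ ^ 2 * m₁ := Nat.mul_le_mul_right _ (by nlinarith)
  have hΔ2 : m₁ ≤ Δ * m₁ := Nat.le_mul_of_pos_left _ hΔ
  have hVm : 2 * Fintype.card V ≤ m := by
    have : 1 ≤ (2 ^ s) ^ Δ := Nat.one_le_pow _ _ (by positivity)
    nlinarith
  obtain ⟨Y₁, hY₁, j₁, hT₁, hL⟩ := exists_tiles (H := H) (R := Rᶜ) m₁ Bᶜ fun U' _ hU' =>
    hasCopyIn_compl_of_free G H R hfree Δ m s hΔ hm hG hH hs hmV hmW U'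
      (hm₁ ▸ hU')
  set L := Bᶜ \ Y₁ with hLdef
  set E : Finset α := {v ∈ L | #{y ∈ B | ¬ R.Adj v y} * (2 * Δ) ≤ #B} with hE
  have hEL : E ⊆ L := filter_subset _ _
  have hLB : L ⊆ Bᶜ := sdiff_subset
  have hdBL : Disjoint B L := disjoint_left.2 fun x hx hx' => mem_compl.1 (hLB hx') hx
  obtain ⟨Y₂, hY₂, j₂, hT₂, hE₂⟩ := exists_tiles (H := H) (R := Rᶜ) r E fun U' hU' hrU' => by
    refine (hr U' hrU').resolve_left ?_
    rintro ⟨S, hS⟩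
    exact hfree (isContained_of_derivedFamily G R Δ hΔ hG B E (hdBL.mono_right hEL)
      (by linarith) (fun v hv => (mem_filter.1 hv).2) S (hS.mono hU'))
  have hdY : Disjoint Y₁ Y₂ := disjoint_left.2 fun x hx hx' =>
    (mem_sdiff.1 (hEL (hY₂ hx'))).2 hx
  have hT := hT₁.union hT₂ hdY
  by_cases hjn : n ≤ j₁ + j₂
  · exact hT.isContained hjn
  obtain ⟨j, rfl⟩ := Nat.exists_eq_add_of_le (not_le.1 hjn).le
  set L' := L \ E with hL'
  have hL'c : #L' < m₁ := (card_le_card sdiff_subset).trans_lt hL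
  have hdBL' : Disjoint B L' := hdBL.mono_right sdiff_subset
  have hcard : #B + #L' + #(E \ Y₂) + #Y₂ + #Y₁ = Fintype.card α := by
    have h1 := card_sdiff_add_card_eq_card hY₂
    have h2 : #L' + #E = #L := card_sdiff_add_card_eq_card hEL
    have h3 : #L + #Y₁ = #Bᶜ := card_sdiff_add_card_eq_card hY₁
    have h4 := card_add_card_compl B
    omega
  have hc₁ := hT₁.card
  have hc₂ := hT₂.card
  have hsize : j * Fintype.card W ≤ #B + #L' := by
    have : (j₁ + j₂ + j) * Fintype.card W =
      j₁ * Fintype.card W + j₂ * Fintype.card W + j * Fintype.card W := by ring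
    omega
  have hfar : ∀ l ∈ L', #B < #{y ∈ B | ¬ R.Adj l y} * (2 * Δ) := by
    intro l hl
    obtain ⟨h1, h2⟩ := mem_sdiff.1 hl
    by_contra h
    exact h2 (mem_filter.2 ⟨h1, not_lt.1 h⟩)
  obtain ⟨Y₃, hY₃, hT₃⟩ := exists_tiles_compl_of_sparse H R B L' Δ m₁ j hΔ hH hdBL' hB1 hBd
    hfar hL'c hsize
  refine (hT.union hT₃ (disjoint_left.2 fun x hx hx' => ?_)).isContained le_rfl
  rcases mem_union.1 (hY₃ hx') with hp | hp <;> rcases mem_union.1 hx with hx | hx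
  · exact mem_compl.1 (hY₁ hx) hp
  · exact disjoint_left.1 hdBL hp (hEL (hY₂ hx))
  · exact (mem_sdiff.1 (mem_sdiff.1 hp).1).2 hx
  · exact (mem_sdiff.1 hp).2 (hY₂ hx)

/-! ### The lower bound and the reduction to an upper bound -/

theorem isContained_comap_compl {W α β : Type*} (H : SimpleGraph W) (R : SimpleGraph α)
    (e : β ↪ α) (h : H.IsContained (R.comap e)ᶜ) : H.IsContained Rᶜ := by
  refine h.trans ⟨⟨⟨e, fun {a b} hab => ⟨e.injective.ne hab.1, fun h' => hab.2 h'⟩⟩, e.injective⟩⟩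

theorem isContained_comap {W α β : Type*} (H : SimpleGraph W) (R : SimpleGraph α)
    (e : β ↪ α) (h : H.IsContained (R.comap e)) : H.IsContained R :=
  h.trans ⟨⟨⟨e, fun {_ _} hab => hab⟩, e.injective⟩⟩

theorem exists_maxIndepSet_superset {V : Type*} [Finite V] (G : SimpleGraph V) (I : Set V)
    (hI : G.IsIndepSet I) : ∃ S : MaxIndepSet G, I ⊆ S.1 := by
  obtain ⟨S, h1, h2⟩ := Finite.exists_le_maximal hI
  exact ⟨⟨S, h2⟩, h1⟩

theorem derivedFamily_isContained {V : Type*} (G : SimpleGraph V) (S : MaxIndepSet G) :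
    (derivedFamily G S).IsContained G :=
  (SimpleGraph.Embedding.induce _).isContained

/-- The extremal colouring: a clique of the second colour, completely joined in the first colour
to a colouring avoiding `𝒟(G)` and `H`. -/
theorem exists_avoiding {V W : Type*} [Finite V] [Fintype W] (G : SimpleGraph V)
    (H : SimpleGraph W) (hH : H.Connected) (t : ℕ) (Q : SimpleGraph (Fin t))
    (hQ : ∀ S, ¬ (derivedFamily G S).IsContained Q) (hQ' : ¬ H.IsContained Qᶜ) (n N : ℕ)
    (hn : 1 ≤ n) (hN : N < n * Fintype.card W + t) :
    ∃ R : SimpleGraph (Fin N), ¬ G.IsContained R ∧ ¬ (disjointCopies n H).IsContained Rᶜ := by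
  have hW : 0 < Fintype.card W := Fintype.card_pos_iff.2 hH.nonempty
  set c := n * Fintype.card W - 1 with hc
  have hpos : 0 < n * Fintype.card W := by positivity
  -- `P` is the second colour, so the cross edges belong to the first.
  set P : SimpleGraph (Fin t ⊕ Fin c) := Qᶜ ⊕g ⊤ with hP
  obtain ⟨e⟩ : Nonempty (Fin N ↪ Fin t ⊕ Fin c) :=
    Function.Embedding.nonempty_of_card_le (by simp; omega)
  refine ⟨Pᶜ.comap e, fun h => ?_, fun h => ?_⟩
  · obtain ⟨f⟩ := isContained_comap _ _ _ h
    -- The vertices sent into the clique are independent in `G`; enlarging them to a maximal `S`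
    -- only shrinks the remainder, which lies in `Q`.
    obtain ⟨S, hS⟩ := exists_maxIndepSet_superset G {v | (f v).isRight} (by
      intro v hv w hw hvw hadj
      have := (f.toHom.map_adj hadj).2
      simp only [SimpleGraph.Copy.toHom_apply] at this
      simp only [Set.mem_ofPred_eq, Sum.isRight_iff] at hv hw
      obtain ⟨a, ha⟩ := hv
      obtain ⟨b, hb⟩ := hw
      rw [ha, hb] at this
      refine this ?_
      simp only [hP, SimpleGraph.sum_adj, SimpleGraph.top_adj]
      rintro rfl
      exact hvw (f.injective (ha.trans hb.symm)))
    have hleft : ∀ v : ↥(S.1ᶜ), ∃ a, f v = Sum.inl a := by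
      intro v
      rw [← Sum.isLeft_iff]
      by_contra hv
      exact v.2 (hS (by simpa using hv))
    choose g hg using hleft
    refine hQ S ⟨⟨⟨g, fun {a b} hab => ?_⟩, fun a b hab => ?_⟩⟩
    · have := (f.toHom.map_adj (show G.Adj a b from hab))
      simp only [SimpleGraph.Copy.toHom_apply, hg, SimpleGraph.compl_adj, hP,
        SimpleGraph.sum_adj] at this
      by_contra h'
      exact this.2 ⟨fun h => this.1 (by rw [h]), h'⟩
    · change g a = g b at hab
      have : f a = f b := by rw [hg, hg, hab]
      exact Subtype.ext (f.injective this)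
  · have h' := isContained_comap_compl _ _ _ h
    rw [compl_compl] at h'
    obtain ⟨f⟩ := h'
    have hstep : ∀ i a b, H.Adj a b → (f (i, a)).isLeft = (f (i, b)).isLeft := by
      intro i a b hab
      have := f.toHom.map_adj (show (disjointCopies n H).Adj (i, a) (i, b) from ⟨rfl, hab⟩)
      simp only [SimpleGraph.Copy.toHom_apply] at this
      rcases hfa : f (i, a) with x | x <;> rcases hfb : f (i, b) with y | y <;>
        simp_all [SimpleGraph.sum_adj]
    have hside : ∀ i a b, (f (i, a)).isLeft = (f (i, b)).isLeft := by
      intro i a b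
      obtain ⟨p⟩ := hH.preconnected a b
      induction p with
      | nil => rfl
      | cons h _ ih => exact (hstep i _ _ h).trans ih
    by_cases hl : ∃ i a, (f (i, a)).isLeft
    · obtain ⟨i, a, hia⟩ := hl
      have hleft : ∀ b, ∃ x, f (i, b) = Sum.inl x := fun b => by
        rw [← Sum.isLeft_iff, ← hside i a b]; exact hia
      choose g hg using hleft
      refine hQ' ⟨⟨⟨g, fun {a b} hab => ?_⟩, fun a b hab => ?_⟩⟩
      · have := f.toHom.map_adj (show (disjointCopies n H).Adj (i, a) (i, b) from ⟨rfl, hab⟩)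
        simpa only [SimpleGraph.Copy.toHom_apply, hg, hP, SimpleGraph.sum_adj] using this
      · change g a = g b at hab
        have : f (i, a) = f (i, b) := by rw [hg, hg, hab]
        simpa using f.injective this
    · push Not at hl
      have hright : ∀ p, ∃ x, f p = Sum.inr x := fun p => by
        rw [← Sum.isRight_iff]
        simpa using hl p.1 p.2
      choose g hg using hright
      have hginj : Function.Injective g := fun p q hpq => f.injective (by
        rw [SimpleGraph.Copy.toHom_apply, SimpleGraph.Copy.toHom_apply, hg, hg, hpq])
      have := Fintype.card_le_of_injective g hginj
      simp at this
      omega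

/-- An edge of `G` makes every member of `𝒟(G)` nonempty. This keeps `r - 1` from truncating, so
that a colouring on `r - 1` vertices can be taken. -/
theorem one_le_ramseyFamily_derivedFamily {V W : Type*} (G : SimpleGraph V) (H : SimpleGraph W)
    [Nonempty W] (hG : G ≠ ⊥) (N : ℕ)
    (hN : ∀ R : SimpleGraph (Fin N), (∃ S, (derivedFamily G S).IsContained R) ∨
      ∃ _ : Unit, H.IsContained Rᶜ) : 1 ≤ N := by
  by_contra h
  obtain rfl : N = 0 := by omega
  rcases hN ⊥ with ⟨S, ⟨f⟩⟩ | ⟨-, ⟨f⟩⟩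
  · have huniv : ∀ v, v ∈ S.1 := fun v => by
      by_contra hv
      exact (f ⟨v, hv⟩).elim0
    refine hG (SimpleGraph.ext (funext fun v => funext fun w => ?_))
    simp only [SimpleGraph.bot_adj, eq_iff_iff, iff_false]
    exact fun hvw => S.2.prop (huniv v) (huniv w) hvw.ne hvw
  · exact (f (Classical.arbitrary W)).elim0

theorem hasCopyIn_of_ramsey {V W α : Type*} (G : SimpleGraph V) (H : SimpleGraph W) (r : ℕ)
    (hr : ∀ R : SimpleGraph (Fin r), (∃ S, (derivedFamily G S).IsContained R) ∨
      ∃ _ : Unit, H.IsContained Rᶜ) (R : SimpleGraph α) (E : Finset α) (hE : r ≤ #E) :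
    (∃ S, HasCopyIn (derivedFamily G S) R E) ∨ HasCopyIn H Rᶜ E := by
  obtain ⟨e⟩ : Nonempty (Fin r ↪ E) := Function.Embedding.nonempty_of_card_le (by simpa using hE)
  have he : Function.Injective fun i => (e i : α) := Subtype.val_injective.comp e.injective
  rcases hr (R.comap fun i => (e i : α)) with ⟨S, ⟨f⟩⟩ | ⟨-, ⟨f⟩⟩
  · exact Or.inl ⟨S, fun v => e (f v), he.comp f.injective, fun v => (e _).2,
      fun a b hab => f.toHom.map_adj hab⟩
  · refine Or.inr ⟨fun v => e (f v), he.comp f.injective, fun v => (e _).2,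
      fun a b hab => ⟨(he.comp f.injective).ne hab.ne, (f.toHom.map_adj hab).2⟩⟩

theorem ramseyNumber_disjointCopies_eq {V W : Type*} [Finite V] [Fintype W] (G : SimpleGraph V)
    (H : SimpleGraph W) (hH : H.Connected) (n r : ℕ) (hn : 1 ≤ n)
    (hr : ramseyFamily (derivedFamily G) (fun _ : Unit => H) = r) (hr1 : 1 ≤ r)
    (hupper : ∀ R : SimpleGraph (Fin (n * Fintype.card W + r - 1)),
      G.IsContained R ∨ (disjointCopies n H).IsContained Rᶜ) :
    (ramseyNumber G (disjointCopies n H) : ℤ) = n * Fintype.card W + r - 1 := by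
  suffices h : ramseyNumber G (disjointCopies n H) = n * Fintype.card W + r - 1 by
    rw [h]; push_cast [Nat.cast_sub (show 1 ≤ n * Fintype.card W + r by omega)]; ring
  have hmem : n * Fintype.card W + r - 1 ∈ {N : ℕ | ∀ R : SimpleGraph (Fin N),
      (∃ _ : Unit, G.IsContained R) ∨ ∃ _ : Unit, (disjointCopies n H).IsContained Rᶜ} :=
    fun R => (hupper R).imp (fun h => ⟨(), h⟩) fun h => ⟨(), h⟩
  refine le_antisymm (Nat.sInf_le hmem) (le_csInf ⟨_, hmem⟩ fun N hN => ?_)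
  · by_contra! hlt
    have hnot : r - 1 ∉ {N : ℕ | ∀ R : SimpleGraph (Fin N),
        (∃ S, (derivedFamily G S).IsContained R) ∨ ∃ _ : Unit, H.IsContained Rᶜ} :=
      Nat.notMem_of_lt_sInf (show r - 1 < ramseyFamily (derivedFamily G) (fun _ : Unit => H) by
        omega)
    simp only [Set.mem_ofPred_eq, not_forall, not_or, not_exists] at hnot
    obtain ⟨Q, hQ, hQ'⟩ := hnot
    obtain ⟨R, h1, h2⟩ := exists_avoiding G H hH (r - 1) Q hQ (hQ' ()) n N hn (by omega)
    rcases hN R with ⟨_, h⟩ | ⟨_, h⟩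
    · exact h1 h
    · exact h2 h

/-! ### Maximum degree one: matchings -/

theorem exists_tiles_of_clique {α : Type*} (R : SimpleGraph α) (U : Finset α)
    (hU : ∀ x ∈ U, ∀ y ∈ U, x ≠ y → R.Adj x y) :
    ∃ Y ⊆ U, ∃ j, #U ≤ 2 * j + 1 ∧ Tiles (⊤ : SimpleGraph (Fin 2)) R Y j := by
  obtain ⟨Y, hY, j, hT, hlt⟩ := exists_tiles (H := (⊤ : SimpleGraph (Fin 2))) (R := R) 2 U
    fun U' hU' h2 => by
      obtain ⟨e⟩ : Nonempty (Fin 2 ↪ U') :=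
        Function.Embedding.nonempty_of_card_le (by simpa using h2)
      have he : Function.Injective fun i => (e i : α) := Subtype.val_injective.comp e.injective
      exact ⟨fun i => e i, he, fun i => (e i).2, fun a b hab =>
        hU _ (hU' (e a).2) _ (hU' (e b).2) (he.ne hab.ne)⟩
  refine ⟨Y, hY, j, ?_, hT⟩
  have h1 := hT.card
  have h2 := card_sdiff_add_card_eq_card hY
  rw [Fintype.card_fin] at h1
  omega

theorem tiles_pair {α : Type*} (R : SimpleGraph α) (x y : α) (h : R.Adj x y) :
    Tiles (⊤ : SimpleGraph (Fin 2)) R {x, y} 1 := by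
  have := tiles_image (H := (⊤ : SimpleGraph (Fin 2))) (R := R) (g := ![x, y]) (by
    intro a b hab
    fin_cases a <;> fin_cases b <;> simp_all [h.ne, h.ne.symm]) (by
    intro a b hab
    fin_cases a <;> fin_cases b <;> simp_all [h.symm])
  convert this using 1
  ext z
  simp [Fin.exists_fin_two, eq_comm]

/-- The Ramsey number of a pair of matchings (Cockayne and Lorimer). -/
theorem exists_matching_or_matching_compl {α : Type*} (R : SimpleGraph α) (m n : ℕ) (hmn : m ≤ n)
    (U : Finset α) (hU : 2 * n + m ≤ #U + 1) :
    (∃ Y ⊆ U, ∃ j, m ≤ j ∧ Tiles (⊤ : SimpleGraph (Fin 2)) R Y j) ∨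
      ∃ Y ⊆ U, ∃ j, n ≤ j ∧ Tiles (⊤ : SimpleGraph (Fin 2)) Rᶜ Y j := by
  induction m generalizing n U with
  | zero => exact Or.inl ⟨∅, by simp, 0, le_rfl, tiles_empty⟩
  | succ m ih =>
    obtain ⟨n, rfl⟩ := Nat.exists_eq_add_of_le' (show 1 ≤ n by omega)
    -- A vertex `v` meeting both colours: deleting `v`, `a`, `b` lowers both `m` and `n` by one and
    -- `2 * n + m` by three, and either matching found extends by `va` or `vb`. Without such a
    -- vertex `U` is monochromatic.
    by_cases hmix : ∃ v ∈ U, ∃ a ∈ U, ∃ b ∈ U, R.Adj v a ∧ v ≠ b ∧ ¬ R.Adj v b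
    · obtain ⟨v, hv, a, ha, b, hb, hva, hvb, hvb'⟩ := hmix
      have hcard : #U ≤ #(U \ {v, a, b}) + 3 := by
        have h1 : #U - #{v, a, b} ≤ #(U \ {v, a, b}) := le_card_sdiff _ _
        have h2 : #{v, a, b} ≤ 3 := card_le_three
        omega
      have hsub : ∀ {x}, x ∈ U → v ∈ U → {v, x} ⊆ U := fun hx hv => by
        simp [insert_subset_iff, hx, hv]
      have hdis : ∀ {x Y}, Y ⊆ U \ {v, a, b} → x = a ∨ x = b → Disjoint Y {v, x} := by
        intro x Y hY hx
        refine disjoint_left.2 fun z hz hz' => (mem_sdiff.1 (hY hz)).2 ?_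
        simp only [mem_insert, mem_singleton] at hz' ⊢
        rcases hz' with rfl | rfl
        · exact Or.inl rfl
        · exact Or.inr hx
      rcases ih n (by omega) (U \ {v, a, b}) (by omega) with ⟨Y, hY, j, hj, hT⟩ | ⟨Y, hY, j, hj, hT⟩
      · exact Or.inl ⟨Y ∪ {v, a}, union_subset (hY.trans sdiff_subset) (hsub ha hv), j + 1,
          by omega, hT.union (tiles_pair R v a hva) (hdis hY (Or.inl rfl))⟩
      · exact Or.inr ⟨Y ∪ {v, b}, union_subset (hY.trans sdiff_subset) (hsub hb hv), j + 1,
          by omega, hT.union (tiles_pair Rᶜ v b ⟨hvb, hvb'⟩) (hdis hY (Or.inr rfl))⟩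
    · push Not at hmix
      by_cases hred : ∃ u ∈ U, ∃ v ∈ U, R.Adj u v
      · obtain ⟨u, hu, v, hv, huv⟩ := hred
        obtain ⟨Y, hY, j, hj, hT⟩ := exists_tiles_of_clique R U (by
          intro x hx y hy hxy
          by_cases hux : u = x
          · subst hux
            exact hmix u hu v hv y hy huv hxy
          · exact hmix x hx u hu y hy (hmix u hu v hv x hx huv hux).symm hxy)
        exact Or.inl ⟨Y, hY, j, by omega, hT⟩
      · push Not at hred
        obtain ⟨Y, hY, j, hj, hT⟩ := exists_tiles_of_clique Rᶜ U
          fun x hx y hy hxy => ⟨hxy, hred x hx y hy⟩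
        exact Or.inr ⟨Y, hY, j, by omega, hT⟩

/-- In a graph of maximum degree one, the vertices outside of a maximal independent set are matched
into it. -/
theorem exists_partner {V : Type*} [Fintype V] (G : SimpleGraph V)
    (hG : ∀ v, #{w | G.Adj v w} ≤ 1) (S : MaxIndepSet G) :
    ∃ σ : ↥(S.1ᶜ) → V, Function.Injective σ ∧ (∀ v, σ v ∈ S.1) ∧
      ∀ (v : ↥(S.1ᶜ)) w, G.Adj v w → w = σ v := by
  have huniq : ∀ {v a b}, G.Adj v a → G.Adj v b → a = b := fun {v a b} ha hb =>
    card_le_one.1 (hG v) a (by simpa using ha) b (by simpa using hb)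
  have hex : ∀ v : ↥(S.1ᶜ), ∃ w ∈ S.1, G.Adj v w := by
    intro v
    by_contra! h
    have hind : G.IsIndepSet (insert v.1 S.1) := by
      refine S.2.prop.insert fun w hw _ => ⟨h w hw, fun h' => h w hw h'.symm⟩
    exact v.2 (S.2.le_of_ge hind (Set.subset_insert _ _) (Set.mem_insert _ _))
  choose σ hσS hσ using hex
  exact ⟨σ, fun v w h => Subtype.ext (huniq (hσ v).symm (h ▸ (hσ w).symm)), hσS,
    fun v w h => huniq h (hσ v)⟩

/-- Every edge of `G` joins a vertex outside `S` to its partner in `S`, so the matching hosts all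
edges; the isolated vertices go anywhere in the remaining room. -/
theorem isContained_of_matching {V α : Type*} [Fintype V] [Fintype α] (G : SimpleGraph V)
    (R : SimpleGraph α) (hG : ∀ v, #{w | G.Adj v w} ≤ 1) (S : MaxIndepSet G)
    (hcard : Fintype.card V ≤ Fintype.card α)
    (h : (disjointCopies (Fintype.card ↥(S.1ᶜ)) (⊤ : SimpleGraph (Fin 2))).IsContained R) :
    G.IsContained R := by
  obtain ⟨σ, hσ, hσS, hσa⟩ := exists_partner G hG S
  obtain ⟨f⟩ := h
  have hf : Function.Injective f := f.injective
  set ε := Fintype.equivFin ↥(S.1ᶜ)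
  set p : ↥(S.1ᶜ) ⊕ ↥(S.1ᶜ) → V := Sum.elim (fun v => v) σ with hp
  have hpinj : Function.Injective p :=
    Subtype.val_injective.sumElim hσ fun a b h => a.2 (h ▸ hσS b)
  set g : ↥(S.1ᶜ) ⊕ ↥(S.1ᶜ) → α := Sum.elim (fun v => f (ε v, 0)) (fun v => f (ε v, 1)) with hg
  have hginj : Function.Injective g := by
    refine Function.Injective.sumElim (fun a b h => ?_) (fun a b h => ?_) fun a b h => ?_
    · simpa using hf h
    · simpa using hf h
    · simpa using hf h
  by_cases hα : Nonempty α
  swap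
  · have : IsEmpty V := Fintype.card_eq_zero_iff.1 (by
      have := Fintype.card_eq_zero_iff.2 (not_nonempty_iff.1 hα)
      omega)
    exact SimpleGraph.IsContained.of_isEmpty
  set q : V → α := Function.extend p g fun _ => Classical.arbitrary α with hq
  have hqp : ∀ x, q (p x) = g x := fun x => hpinj.extend_apply _ _ x
  have hqinj : Set.InjOn q (univ.image p : Finset V) := by
    intro v hv w hw h
    simp only [coe_image, coe_univ, Set.image_univ, Set.mem_range] at hv hw
    obtain ⟨x, rfl⟩ := hv
    obtain ⟨y, rfl⟩ := hw
    rw [hqp, hqp] at h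
    rw [hginj h]
  obtain ⟨t, ht, htc⟩ := exists_superset_card_eq (s := (univ.image p).image q)
    (n := Fintype.card V) (card_image_le.trans (card_le_univ _)) hcard
  obtain ⟨e, he⟩ := exists_equiv_extend_of_card_eq htc.symm ht hqinj
  have hep : ∀ x, (e (p x) : α) = g x := fun x =>
    (he _ (mem_image_of_mem _ (mem_univ _))).trans (hqp x)
  have hadj : ∀ v : ↥(S.1ᶜ), R.Adj (e v) (e (σ v)) := by
    intro v
    have h1 := hep (Sum.inl v)
    have h2 := hep (Sum.inr v)
    simp only [hp, hg, Sum.elim_inl, Sum.elim_inr] at h1 h2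
    rw [h1, h2]
    exact f.toHom.map_adj ⟨rfl, by simp⟩
  refine ⟨⟨⟨fun v => e v, fun {v w} hvw => ?_⟩, Subtype.val_injective.comp e.injective⟩⟩
  by_cases hv : v ∈ S.1
  · have hw : w ∉ S.1 := fun hw => S.2.prop hv hw hvw.ne hvw
    rw [hσa ⟨w, hw⟩ v hvw.symm]
    exact (hadj ⟨w, hw⟩).symm
  · rw [hσa ⟨v, hv⟩ w hvw]
    exact hadj ⟨v, hv⟩

theorem card_le_two_of_connected {W : Type*} [Fintype W] (H : SimpleGraph W) (hH : H.Connected)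
    (hdeg : ∀ v, #{w | H.Adj v w} ≤ 1) : Fintype.card W ≤ 2 := by
  obtain ⟨a⟩ := hH.nonempty
  have huniq : ∀ {v x y}, H.Adj v x → H.Adj v y → x = y := fun {v x y} hx hy =>
    card_le_one.1 (hdeg v) x (by simpa using hx) y (by simpa using hy)
  have hclosed : ∀ v w, (v = a ∨ H.Adj a v) → H.Adj v w → (w = a ∨ H.Adj a w) := by
    rintro v w (rfl | hv) hvw
    · exact Or.inr hvw
    · exact Or.inl (huniq hvw hv.symm)
  have hall : ∀ v, v = a ∨ H.Adj a v := by
    intro v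
    obtain ⟨p⟩ := hH.preconnected v a
    induction p with
    | nil => exact Or.inl rfl
    | cons h _ ih => exact hclosed _ _ (ih hclosed) h.symm
  have hsub : (univ : Finset W) ⊆ {a} ∪ ({w | H.Adj a w} : Finset W) := fun v _ => by
    simpa using hall v
  rw [← card_univ]
  have h1 := card_le_card hsub
  have h2 := card_union_le {a} ({w | H.Adj a w} : Finset W)
  have h3 := hdeg a
  rw [card_singleton] at h2
  omega

theorem disjointCopies_isContained_of_subsingleton {W α : Type*} [Fintype W] [Fintype α]
    [Subsingleton W] (H : SimpleGraph W) (R : SimpleGraph α) (n : ℕ)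
    (h : n * Fintype.card W ≤ Fintype.card α) : (disjointCopies n H).IsContained R := by
  obtain ⟨e⟩ : Nonempty (Fin n × W ↪ α) :=
    Function.Embedding.nonempty_of_card_le (by simpa using h)
  exact ⟨⟨⟨e, fun {a b} hab => absurd (Subsingleton.elim a.2 b.2) hab.2.ne⟩, e.injective⟩⟩

/-- The upper bound for graphs of maximum degree one. -/
theorem isContained_or_of_degree_le_one {V W α : Type*} [Fintype V] [Fintype W] [Fintype α]
    (G : SimpleGraph V) (H : SimpleGraph W) (hH : H.Connected) (hGd : ∀ v, #{w | G.Adj v w} ≤ 1)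
    (hHd : ∀ v, #{w | H.Adj v w} ≤ 1) (n r : ℕ) (hn : Fintype.card V ≤ n * Fintype.card W)
    (hr1 : 1 ≤ r) (hr : ∀ R : SimpleGraph (Fin r), (∃ S, (derivedFamily G S).IsContained R) ∨
      ∃ _ : Unit, H.IsContained Rᶜ)
    (hα : n * Fintype.card W + r ≤ Fintype.card α + 1) (R : SimpleGraph α) :
    G.IsContained R ∨ (disjointCopies n H).IsContained Rᶜ := by
  have hW : 0 < Fintype.card W := Fintype.card_pos_iff.2 hH.nonempty
  have hW2 := card_le_two_of_connected H hH hHd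
  rcases (show Fintype.card W = 1 ∨ Fintype.card W = 2 by omega) with hW1 | hW2
  · have : Subsingleton W := Fintype.card_le_one_iff_subsingleton.1 hW1.le
    exact Or.inr (disjointCopies_isContained_of_subsingleton H _ n (by omega))
  rw [hW2] at hn hα
  have hWn : Nontrivial W := Fintype.one_lt_card_iff_nontrivial.1 (by omega)
  -- The colouring using only the first colour has no `H` in the second, so it yields an `S` whose
  -- complement has at most `r` vertices.
  obtain ⟨S, ⟨f⟩⟩ : ∃ S, (derivedFamily G S).IsContained (⊤ : SimpleGraph (Fin r)) := by
    refine (hr ⊤).resolve_right ?_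
    rintro ⟨-, ⟨f⟩⟩
    obtain ⟨a, b, hab⟩ := exists_pair_ne W
    obtain ⟨p⟩ := hH.preconnected a b
    cases p with
    | nil => exact hab rfl
    | cons h _ =>
      have := f.toHom.map_adj h
      simp at this
  have hmr : Fintype.card ↥(S.1ᶜ) ≤ r := by
    simpa using Fintype.card_le_of_injective f f.injective
  have hmV : 2 * Fintype.card ↥(S.1ᶜ) ≤ Fintype.card V := by
    obtain ⟨σ, hσ, hσS, -⟩ := exists_partner G hGd S
    have := Fintype.card_le_of_injective (Sum.elim (fun v : ↥(S.1ᶜ) => (v : V)) σ)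
      (Subtype.val_injective.sumElim hσ fun a b h => a.2 (h ▸ hσS b))
    rw [Fintype.card_sum] at this
    omega
  rcases exists_matching_or_matching_compl R (Fintype.card ↥(S.1ᶜ)) n (by omega) univ
    (by rw [card_univ]; omega) with ⟨Y, -, j, hj, hT⟩ | ⟨Y, -, j, hj, hT⟩
  · exact Or.inl (isContained_of_matching G R hGd S (by omega) (hT.isContained hj))
  · refine Or.inr (SimpleGraph.IsContained.trans ?_ (hT.isContained hj))
    have e := Fintype.equivFinOfCardEq hW2
    refine ⟨⟨⟨fun p => (p.1, e p.2), fun {p q} hpq => ⟨hpq.1, ?_⟩⟩, ?_⟩⟩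
    · simpa using hpq.2.ne
    · rintro ⟨a, w⟩ ⟨b, w'⟩ h
      change (a, e w) = (b, e w') at h
      simpa using h

/-! ### Numerical bounds and assembly -/

/-- Here `t` stands for the rounded-up logarithm of `Δ`, and `2 * t + 7` makes the power of two at
least `128 * Δ ^ 2`. The constant is 244 = 2 · 13 · 9 + 10: two powers of the base and the remaining
factor. -/
theorem threshold_le (Δ t k : ℕ) (hΔ : 1 ≤ Δ) (ht : 1 ≤ t) (hΔt : Δ ≤ 2 ^ t) :
    (4 * (2 * Δ * (2 ^ (2 * t + 7)) ^ Δ)) ^ (2 * t + 7) *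
      ((4 * (2 * Δ * (2 ^ (2 * t + 7)) ^ Δ)) ^ (2 * t + 7) * (2 * (2 ^ (2 * t + 7)) ^ Δ * k)) ≤
      2 ^ (244 * t ^ 2 * Δ) * k := by
  obtain ⟨s, hs⟩ : ∃ s, s = 2 * t + 7 := ⟨_, rfl⟩
  rw [← hs]
  have h1 : 4 * (2 * Δ * (2 ^ s) ^ Δ) ≤ 2 ^ (3 + t + s * Δ) := by
    calc 4 * (2 * Δ * (2 ^ s) ^ Δ) = 8 * Δ * 2 ^ (s * Δ) := by rw [pow_mul]; ring
      _ ≤ 8 * 2 ^ t * 2 ^ (s * Δ) := by gcongr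
      _ = _ := by rw [pow_add, pow_add]; norm_num
  have hexp : (3 + t + s * Δ) * s + ((3 + t + s * Δ) * s + (1 + s * Δ)) ≤ 244 * t ^ 2 * Δ := by
    have hst : s ≤ 9 * t := by omega
    have a1 : s * Δ ≤ 9 * t * Δ := Nat.mul_le_mul_right _ hst
    have a2 : t ≤ t * Δ := Nat.le_mul_of_pos_right _ hΔ
    have a3 : 3 + t + s * Δ ≤ 13 * (t * Δ) := by nlinarith
    have a4 : (3 + t + s * Δ) * s ≤ 13 * (t * Δ) * (9 * t) := Nat.mul_le_mul a3 hst
    have a5 : t * Δ ≤ t ^ 2 * Δ := Nat.mul_le_mul_right _ (by nlinarith)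
    nlinarith
  calc _ ≤ (2 ^ (3 + t + s * Δ)) ^ s * ((2 ^ (3 + t + s * Δ)) ^ s * (2 * (2 ^ s) ^ Δ * k)) := by
        gcongr
    _ = 2 ^ ((3 + t + s * Δ) * s + ((3 + t + s * Δ) * s + (1 + s * Δ))) * k := by
        rw [pow_add _ (_ * s), pow_add _ (_ * s), pow_add _ 1, pow_mul _ _ s, pow_mul _ s]; ring
    _ ≤ _ := Nat.mul_le_mul_right _ (Nat.pow_le_pow_right (by norm_num) hexp)

/-- Rounding up at most doubles a logarithm that is at least 1; squaring gives 976 = 4 · 244. -/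
theorem two_pow_le_rpow_logb (Δ : ℕ) (hΔ : 2 ≤ Δ) :
    (2 : ℝ) ^ (244 * Nat.clog 2 Δ ^ 2 * Δ) ≤
      (2 : ℝ) ^ (976 * (Δ : ℝ) * Real.logb 2 (Δ : ℝ) ^ 2) := by
  have hΔ' : (2 : ℝ) ≤ Δ := by exact_mod_cast hΔ
  have hl : 1 ≤ Real.logb 2 (Δ : ℝ) := by
    rw [Real.le_logb_iff_rpow_le (by norm_num) (by linarith)]
    simpa using hΔ'
  have ht : (Nat.clog 2 Δ : ℝ) ≤ 2 * Real.logb 2 (Δ : ℝ) := by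
    have h1 : 2 ^ (Nat.clog 2 Δ - 1) < Δ := Nat.pow_pred_clog_lt_self (by norm_num) (by omega)
    have h2 : ((Nat.clog 2 Δ - 1 : ℕ) : ℝ) ≤ Real.logb 2 (Δ : ℝ) := by
      rw [Real.le_logb_iff_rpow_le (by norm_num) (by linarith), Real.rpow_natCast]
      exact_mod_cast h1.le
    have h3 : (Nat.clog 2 Δ : ℝ) ≤ ((Nat.clog 2 Δ - 1 : ℕ) : ℝ) + 1 := by
      have : Nat.clog 2 Δ ≤ Nat.clog 2 Δ - 1 + 1 := by omega
      exact_mod_cast this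
    linarith
  rw [← Real.rpow_natCast]
  refine Real.rpow_le_rpow_of_exponent_le (by norm_num) ?_
  push_cast
  have h4 : (Nat.clog 2 Δ : ℝ) ^ 2 ≤ (2 * Real.logb 2 (Δ : ℝ)) ^ 2 := by gcongr
  nlinarith

theorem card_adj_le_of_maxDegree_le {V : Type*} [Fintype V] (G : SimpleGraph V)
    [DecidableRel G.Adj] (Δ : ℕ) (h : G.maxDegree ≤ Δ) (v : V) :
    #(@filter V (fun w => G.Adj v w) (fun _ => Classical.propDecidable _) univ) ≤ Δ := by
  refine le_trans (le_of_eq ?_) ((G.degree_le_maxDegree v).trans h)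
  rw [← G.card_neighborFinset_eq_degree]
  congr 1
  ext w
  simp

theorem one_le_of_ne_bot {V : Type*} [Fintype V] (G : SimpleGraph V) (hG : G ≠ ⊥) (Δ : ℕ)
    (h : ∀ v, #{w | G.Adj v w} ≤ Δ) : 1 ≤ Δ := by
  by_contra hΔ
  obtain rfl : Δ = 0 := by omega
  refine hG (SimpleGraph.ext (funext fun v => funext fun w => ?_))
  simp only [SimpleGraph.bot_adj, eq_iff_iff, iff_false]
  intro hvw
  have h0 := card_eq_zero.1 (Nat.le_zero.1 (h v))
  exact notMem_empty w (h0 ▸ mem_filter.2 ⟨mem_univ _, hvw⟩)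

/-- The family `𝒟(G)` together with `H` has a finite Ramsey number. -/
theorem ramseyFamily_derivedFamily_mem {V W : Type*} [Fintype V] [Fintype W] (G : SimpleGraph V)
    (H : SimpleGraph W) (Δ : ℕ) (hΔ : 1 ≤ Δ) (hG : ∀ v, #{w | G.Adj v w} ≤ Δ)
    (hH : ∀ v, #{w | H.Adj v w} ≤ Δ)
    (R : SimpleGraph (Fin (ramseyFamily (derivedFamily G) fun _ : Unit => H))) :
    (∃ S, (derivedFamily G S).IsContained R) ∨ ∃ _ : Unit, H.IsContained Rᶜ := by
  -- An infimum over the empty set would be the default 0, so some valid `N` must be exhibited. If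
  -- `R` contains `G` it contains a member of `𝒟(G)`; otherwise the bounded degree bound provides
  -- `H`.
  refine Nat.sInf_mem (s := {N : ℕ | ∀ R : SimpleGraph (Fin N),
    (∃ S, (derivedFamily G S).IsContained R) ∨ ∃ _ : Unit, H.IsContained Rᶜ}) ?_ R
  obtain ⟨s, hs⟩ := pow_unbounded_of_one_lt (128 * Δ ^ 2) (one_lt_two (α := ℕ))
  set m := 2 * (2 ^ s) ^ Δ * Fintype.card V + Fintype.card W + 1 with hm
  refine ⟨(4 * (2 * Δ * (2 ^ s) ^ Δ)) ^ s * m, fun R => ?_⟩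
  by_cases hfree : G.IsContained R
  · obtain ⟨S, -⟩ := exists_maxIndepSet_superset G ∅ (by simp [SimpleGraph.IsIndepSet])
    exact Or.inl ⟨S, (derivedFamily_isContained G S).trans hfree⟩
  · refine Or.inr ⟨(), (hasCopyIn_compl_of_free G H R hfree Δ m s hΔ (by omega) hG hH hs.le
      (by omega) (by omega) univ ?_).isContained⟩
    rw [card_univ, Fintype.card_fin]
end

theorem theorem1p4 :
    ∃ C : ℝ, 0 < C ∧
      ∀ (V W : Type*) [Fintype V] [Fintype W] (G : SimpleGraph V) (H : SimpleGraph W)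
        [DecidableRel G.Adj] [DecidableRel H.Adj] (Δ n : ℕ),
        G ≠ ⊥ → H.Connected → G.maxDegree ≤ Δ → H.maxDegree ≤ Δ →
        (2 : ℝ) ^ (C * (Δ : ℝ) * Real.logb 2 (Δ : ℝ) ^ 2) *
            (max (Fintype.card V) (Fintype.card W) : ℕ) / (Fintype.card W : ℝ) ≤ (n : ℝ) →
        (ramseyNumber G (disjointCopies n H) : ℤ) =
          n * Fintype.card W + ramseyFamily (derivedFamily G) (fun _ : Unit => H) - 1 := by
  refine ⟨976, by norm_num, ?_⟩
  intro V W _ _ G H _ _ Δ n hG hH hGd hHd hn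
  have : Nonempty W := hH.nonempty
  have hW : 0 < Fintype.card W := Fintype.card_pos
  have hG' := card_adj_le_of_maxDegree_le G Δ hGd
  have hH' := card_adj_le_of_maxDegree_le H Δ hHd
  have hΔ : 1 ≤ Δ := one_le_of_ne_bot G hG Δ hG'
  rw [div_le_iff₀ (by exact_mod_cast hW)] at hn
  have hexp : (0 : ℝ) ≤ 976 * (Δ : ℝ) * Real.logb 2 (Δ : ℝ) ^ 2 := by positivity
  have hk : max (Fintype.card V) (Fintype.card W) ≤ n * Fintype.card W := by
    have h1 := Real.one_le_rpow (one_le_two (α := ℝ)) hexp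
    have h2 : ((max (Fintype.card V) (Fintype.card W) : ℕ) : ℝ) ≤ n * Fintype.card W :=
      (le_mul_of_one_le_left (Nat.cast_nonneg _) h1).trans hn
    exact_mod_cast h2
  have hn1 : 1 ≤ n := by
    by_contra h
    obtain rfl : n = 0 := by omega
    have := (le_max_right _ _).trans hk
    omega
  have hr := ramseyFamily_derivedFamily_mem G H Δ hΔ hG' hH'
  have hr1 := one_le_ramseyFamily_derivedFamily G H hG _ hr
  refine ramseyNumber_disjointCopies_eq G H hH n _ hn1 rfl hr1 fun R => ?_
  -- For `Δ = 1` the exponent is 0 and the hypothesis on `n` yields no more than `hk`.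
  rcases hΔ.eq_or_lt with rfl | hΔ2
  · exact isContained_or_of_degree_le_one G H hH hG' hH' n _ ((le_max_left _ _).trans hk) hr1 hr
      (by rw [Fintype.card_fin]; omega) R
  refine or_iff_not_imp_left.2 fun hfree => ?_
  have hclog : 1 ≤ Nat.clog 2 Δ := Nat.clog_pos (by norm_num) hΔ2
  have hΔc : Δ ≤ 2 ^ Nat.clog 2 Δ := Nat.le_pow_clog (by norm_num) _
  have hq : 1 ≤ (2 ^ (2 * Nat.clog 2 Δ + 7)) ^ Δ := Nat.one_le_pow _ _ (by positivity)
  have hbound : 2 ^ (244 * Nat.clog 2 Δ ^ 2 * Δ) * max (Fintype.card V) (Fintype.card W) ≤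
      n * Fintype.card W := by
    have h := (mul_le_mul_of_nonneg_right (two_pow_le_rpow_logb Δ hΔ2)
      (Nat.cast_nonneg (max (Fintype.card V) (Fintype.card W)))).trans hn
    exact_mod_cast h
  refine disjointCopies_isContained_compl G H R hfree Δ
    (2 * (2 ^ (2 * Nat.clog 2 Δ + 7)) ^ Δ * max (Fintype.card V) (Fintype.card W))
    (2 * Nat.clog 2 Δ + 7) _ n hΔ ?_ hG' hH' ?_ (Nat.mul_le_mul_left _ (le_max_left _ _)) ?_
    (hasCopyIn_of_ramsey G H _ hr R) ?_ ?_
  · have : 1 ≤ max (Fintype.card V) (Fintype.card W) := le_max_of_le_right hW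
    exact Nat.mul_pos (by positivity) this
  · rw [pow_add, mul_comm 2, pow_mul]
    have := Nat.pow_le_pow_left hΔc 2
    omega
  · exact (le_max_right _ _).trans (Nat.le_mul_of_pos_left _ (by positivity))
  · refine (threshold_le Δ _ _ hΔ hclog hΔc).trans (hbound.trans ?_)
    rw [Fintype.card_fin]
    omega
  · rw [Fintype.card_fin]
    omega
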